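/- Let $d\ge 1$ and let $\|\cdot\|$ be the Euclidean norm on $\mathbb R^d$. The Zygmund class $\Lambda_*(\mathbb R^d)$ consists of the bounded continuous functions $f\colon\mathbb R^d\to\mathbb R$ such that $$\sup\Big\{\frac{|f(x+h)+f(x-h)-2f(x)|}{\|h\|} : x,h\in\mathbb R^d,\ h\neq 0\Big\}<\infty,$$ and the small Zygmund class $\lambda_*(\mathbb R^d)$ consists of those $f\in\Lambda_*(\mathbb R^d)$ such that $$\lim_{\|h\|\to 0}\ \sup_{x\in\mathbb R^d}\frac{|f(x+h)+f(x-h)-2f(x)|}{\|h\|}=0 .$$ For $f\colon\mathbb R^d\to\mathbb R$ put $$E(f)=\Big\{x\in\mathbb R^d : \limsup_{\|h\|\to 0}\frac{|f(x+h)-f(x)|}{\|h\|}<\infty\Big\}.$$ (a) Let $f\in\Lambda_*(\mathbb R^d)$. Then $E(f)$ has Hausdorff dimension at least $1$; moreover, for every open cube $Q\subset\mathbb R^d$ with sides parallel to the coordinate axes and positive side length, $E(f)\cap Q$ has Hausdorff dimension at least $1$. (b) Let $f\in\lambda_*(\mathbb R^d)$. Then the set of points at which $f$ is differentiable has Hausdorff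 dimension at least $1$; moreover, for every open cube $Q\subset\mathbb R^d$ with sides parallel to the coordinate axes and positive side length, the set of points of $Q$ at which $f$ is differentiable has Hausdorff dimension at least $1$. -/

import Mathlib

open Filter Topology

/-- The Zygmund class `Λ_*(ℝ^d)`: bounded continuous `f : ℝ^d → ℝ` for which the quotients
`|f (x + h) + f (x - h) - 2 f x| / ‖h‖`, over all `x` and all `h ≠ 0`, are bounded.
(For `h = 0` the inequality below reads `0 ≤ 0`.) -/
def zygmundClass (d : ℕ) : Set (EuclideanSpace ℝ (Fin d) → ℝ) :=
  {f | (∃ M : ℝ, ∀ x, |f x| ≤ M) ∧ Continuous f ∧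
    ∃ C : ℝ, ∀ x h, |f (x + h) + f (x - h) - 2 * f x| ≤ C * ‖h‖}

/-- The small Zygmund class `λ_*(ℝ^d)`: those `f` in the Zygmund class for which
`|f (x + h) + f (x - h) - 2 f x| / ‖h‖` tends to `0` as `‖h‖ → 0`, uniformly in `x`. -/
def smallZygmundClass (d : ℕ) : Set (EuclideanSpace ℝ (Fin d) → ℝ) :=
  {f | f ∈ zygmundClass d ∧
    ∀ ε : ℝ, 0 < ε → ∃ δ : ℝ, 0 < δ ∧
      ∀ x h, ‖h‖ < δ → |f (x + h) + f (x - h) - 2 * f x| ≤ ε * ‖h‖}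

/-- The set `E(f)` of points where the divided differences of `f` stay bounded:
`limsup_{h → 0} |f (x + h) - f x| / ‖h‖ < ∞` (the limsup is taken in `[0, ∞]`). -/
def boundedDivDiffSet {d : ℕ} (f : EuclideanSpace ℝ (Fin d) → ℝ) :
    Set (EuclideanSpace ℝ (Fin d)) :=
  {x | limsup (fun h : EuclideanSpace ℝ (Fin d) => ENNReal.ofReal (|f (x + h) - f x| / ‖h‖))
    (𝓝[≠] 0) < ⊤}

/-- The set of points where `f` is (Fréchet) differentiable. -/
def differentiabilitySet {d : ℕ} (f : EuclideanSpace ℝ (Fin d) → ℝ) :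
    Set (EuclideanSpace ℝ (Fin d)) :=
  {x | DifferentiableAt ℝ f x}

/-- The open cube with lower corner `a` and side length `r`, sides parallel to the axes. -/
def openCube {d : ℕ} (a : EuclideanSpace ℝ (Fin d)) (r : ℝ) : Set (EuclideanSpace ℝ (Fin d)) :=
  {x | ∀ i, a i < x i ∧ x i < a i + r}

/-! The problem reduces to one real variable. Fix a unit vector e and put q = f - K‖· - c‖², with K
so large that the maximum of q over each disc of radius ρ, orthogonal to e and centred on the axis c
+ ℝe, is attained off the disc's rim (`exists_sliceSup`). The maximum F(t) over the disc at height t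
inherits a lower Zygmund inequality, has an interior local maximum, and passes every upper bound on
its increments at t to q at a maximiser x. The Zygmund inequality makes such bounds two-sided, so f
has bounded divided differences at x, or is differentiable there. As x ↦ ⟨e, x - c⟩ is 1-Lipschitz,
it suffices that the set E of good heights has dimension at least 1.

Suppose dim E < 1 (`one_le_dimH_of_localMax`). Then E is null and, for some s < 1, has covers by
intervals of radii uᵢ with Σ uᵢ^s arbitrarily small. Starting from the local maximum, nested
intervals are built on which F lies below a line through its value at the centre. The supremal
convolution with a steep cone is Lipschitz, hence differentiable almost everywhere, so almost every
contact point is good and the contact set is null. A definite proportion of points then see their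
contact point strictly on a prescribed side; each yields a much smaller interval with slope changed
by ±N (`NearlyAffine.exists_add`, `NearlyAffine.exists_sub`), and the sign is chosen against the
current slope. By Vitali and a counting argument, the cover is again light on one of them
(`exists_coverMass_le`). The common point of the intervals escapes the cover, but its increments are
controlled at all scales, so it lies in E: a contradiction. In the small class the constants tend to
0 along the scales. -/

section OneDimensional

open MeasureTheory Set Metric

/-! ### Light covers and Vitali selection -/

/-- The total `s`-mass of those intervals `[p i - u i, p i + u i]` that meet `[b - r, b + r]`. -/
noncomputable def coverMass (s : ℝ) (p u : ℕ → ℝ) (b r : ℝ) : ℝ :=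
  ∑' i, {i | |p i - b| ≤ r + u i}.indicator (fun i => u i ^ s) i

theorem summable_coverMass {s : ℝ} {p u : ℕ → ℝ} (hsum : Summable fun i => u i ^ s) (b r : ℝ) :
    Summable ({i | |p i - b| ≤ r + u i}.indicator (fun i => u i ^ s)) :=
  hsum.indicator _

theorem coverMass_le_tsum {s : ℝ} {p u : ℕ → ℝ} (hu : ∀ i, 0 < u i)
    (hsum : Summable fun i => u i ^ s) (b r : ℝ) : coverMass s p u b r ≤ ∑' i, u i ^ s := by
  refine (summable_coverMass hsum b r).tsum_le_tsum (fun i => ?_) hsum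
  exact indicator_le_self' (fun i _ => Real.rpow_nonneg (hu i).le s) i

theorem le_of_coverMass_le {s κ : ℝ} (hs : 0 < s) {p u : ℕ → ℝ} (hu : ∀ i, 0 < u i)
    (hsum : Summable fun i => u i ^ s) {b r : ℝ} (hκ : 0 ≤ κ) (h : coverMass s p u b r ≤ κ ^ s)
    {i : ℕ} (hi : |p i - b| ≤ r + u i) : u i ≤ κ := by
  have h1 : u i ^ s ≤ coverMass s p u b r := by
    have := (summable_coverMass (p := p) hsum b r).le_tsum i
      (fun j _ => indicator_nonneg (fun i _ => Real.rpow_nonneg (hu i).le s) j)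
    rwa [indicator_of_mem (show i ∈ {i | |p i - b| ≤ r + u i} from hi)] at this
  exact (Real.rpow_le_rpow_iff (hu i).le hκ hs).1 (h1.trans h)

theorem coverMass_neg (s : ℝ) (p u : ℕ → ℝ) (b r : ℝ) :
    coverMass s (fun i => -p i) u (-b) r = coverMass s p u b r := by
  have : ∀ i, |-p i - -b| = |p i - b| := fun i => by rw [← abs_neg]; congr 1; ring
  simp only [coverMass, this]

/-- Disjoint balls of radius at least `u` meet an interval of radius `u` at most twice. -/
theorem card_filter_meets_le_two {F : Finset ℝ} {c ρ : ℝ → ℝ} {p u : ℝ}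
    (hdisj : (F : Set ℝ).PairwiseDisjoint fun a => closedBall (c a) (ρ a))
    (hρ : ∀ t ∈ F, |p - c t| ≤ ρ t + u → u ≤ ρ t) :
    (F.filter fun t => |p - c t| ≤ ρ t + u).card ≤ 2 := by
  classical
  have one : ∀ x : ℝ, (F.filter fun t => x ∈ closedBall (c t) (ρ t)).card ≤ 1 := by
    intro x
    refine Finset.card_le_one.2 fun a ha b hb => ?_
    rw [Finset.mem_filter] at ha hb
    by_contra hab
    exact (Set.disjoint_left.1 (hdisj ha.1 hb.1 hab)) ha.2 hb.2
  -- A ball at least as long as the interval it meets contains one of its endpoints, and each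
  -- endpoint lies in at most one ball.
  have sub : (F.filter fun t => |p - c t| ≤ ρ t + u) ⊆
      (F.filter fun t => p - u ∈ closedBall (c t) (ρ t)) ∪
        (F.filter fun t => p + u ∈ closedBall (c t) (ρ t)) := by
    intro t ht
    rw [Finset.mem_filter] at ht
    have h1 := hρ t ht.1 ht.2
    have h2 := abs_le.1 ht.2
    simp only [Finset.mem_union, Finset.mem_filter, mem_closedBall, Real.dist_eq, abs_le]
    rcases le_total p (c t) with h | h
    · exact Or.inr ⟨ht.1, by linarith, by linarith⟩
    · exact Or.inl ⟨ht.1, by linarith, by linarith⟩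
  have h1 := one (p - u)
  have h2 := one (p + u)
  have h3 := (Finset.card_le_card sub).trans (Finset.card_union_le _ _)
  omega

/-- A finite disjoint subfamily of a family of balls, carrying a definite part of the measure. -/
theorem exists_finset_pairwiseDisjoint_closedBall {R : Set ℝ} {c ρ : ℝ → ℝ} {B m : ℝ}
    (hpos : ∀ t ∈ R, 0 < ρ t) (hB : ∀ t ∈ R, ρ t ≤ B) (hmem : ∀ t ∈ R, |t - c t| ≤ ρ t)
    (hR : ENNReal.ofReal (10 * m) < volume R) :
    ∃ F : Finset ℝ, (F : Set ℝ) ⊆ R ∧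
      ((F : Set ℝ).PairwiseDisjoint fun a => closedBall (c a) (ρ a)) ∧ m < ∑ t ∈ F, ρ t := by
  classical
  obtain ⟨T, hTR, hTd, hTc⟩ := Vitali.exists_disjoint_subfamily_covering_enlargement_closedBall
    R c ρ B hB 5 (by norm_num)
  have hcount : T.Countable := hTd.countable_of_nonempty_interior fun a ha =>
    ⟨c a, ball_subset_interior_closedBall (mem_ball_self (hpos a (hTR ha)))⟩
  by_contra! H
  refine hR.not_ge ?_
  have hcov : R ⊆ ⋃ a ∈ T, closedBall (c a) (5 * ρ a) := by
    intro t ht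
    obtain ⟨a, ha, hsub⟩ := hTc t ht
    exact mem_iUnion₂.2 ⟨a, ha, hsub (by simpa [Real.dist_eq] using hmem t ht)⟩
  calc volume R ≤ volume (⋃ a ∈ T, closedBall (c a) (5 * ρ a)) := measure_mono hcov
    _ ≤ ∑' a : T, volume (closedBall (c a) (5 * ρ a)) := measure_biUnion_le _ hcount _
    _ ≤ ENNReal.ofReal (10 * m) := by
      rw [ENNReal.tsum_eq_iSup_sum]
      refine iSup_le fun G => ?_
      simp only [Real.volume_closedBall]
      rw [← ENNReal.ofReal_sum_of_nonneg
        (fun a _ => by have := hpos a (hTR a.2); positivity)]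
      refine ENNReal.ofReal_le_ofReal ?_
      have hGT : ((G.image Subtype.val : Finset ℝ) : Set ℝ) ⊆ T := by
        intro x hx
        simp only [Finset.coe_image, mem_image] at hx
        obtain ⟨y, -, rfl⟩ := hx
        exact y.2
      have := H (G.image Subtype.val) (hGT.trans hTR) (hTd.subset hGT)
      rw [Finset.sum_image (fun x _ y _ h => Subtype.ext h)] at this
      have e : ∑ a ∈ G, 2 * (5 * ρ a) = 10 * ∑ a ∈ G, ρ a := by
        rw [Finset.mul_sum]; exact Finset.sum_congr rfl fun _ _ => by ring
      rw [e]
      linarith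

/-- Since s < 1 and the radii are at most r/96, Σ 6uᵢ ≤ 6 (r/96)^(1-s) Σ uᵢ^s ≤ r/16. The 96 is
chosen so that this is half of the r/8 available in `exists_coverMass_le`. -/
theorem volume_biUnion_cover_le {s r b : ℝ} (hs1 : s < 1) (hr : 0 < r)
    {p u : ℕ → ℝ} (hu : ∀ i, 0 < u i) (hsum : Summable fun i => u i ^ s)
    (hle : ∀ i, |p i - b| ≤ r + u i → u i ≤ r / 96)
    (hΦ : coverMass s p u b r ≤ (r / 96) ^ s) :
    volume (⋃ i ∈ {i | |p i - b| ≤ r + u i}, closedBall (p i) (3 * u i)) ≤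
      ENNReal.ofReal (r / 16) := by
  set A := {i | |p i - b| ≤ r + u i} with hA
  have hterm : ∀ i, A.indicator (fun i => 6 * u i) i ≤
      6 * (r / 96) ^ (1 - s) * A.indicator (fun i => u i ^ s) i := by
    intro i
    by_cases hi : i ∈ A
    · rw [indicator_of_mem hi, indicator_of_mem hi]
      have h1 : u i = u i ^ (1 - s) * u i ^ s := by
        rw [← Real.rpow_add (hu i)]; simp
      have h2 : u i ^ (1 - s) ≤ (r / 96) ^ (1 - s) :=
        Real.rpow_le_rpow (hu i).le (hle i hi) (by linarith)
      have h3 := mul_le_mul_of_nonneg_right h2 (Real.rpow_nonneg (hu i).le s)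
      linarith
    · simp [indicator_of_notMem hi]
  have hS := (summable_coverMass (p := p) hsum b r).mul_left (6 * (r / 96) ^ (1 - s))
  have hnn : ∀ i, 0 ≤ A.indicator (fun i => 6 * u i) i :=
    fun i => indicator_nonneg (fun i _ => by have := hu i; positivity) i
  have hS' : Summable (A.indicator (fun i => 6 * u i)) := hS.of_nonneg_of_le hnn hterm
  calc volume (⋃ i ∈ A, closedBall (p i) (3 * u i))
      ≤ ∑' i : A, volume (closedBall (p i) (3 * u i)) := measure_biUnion_le _ A.to_countable _
    _ = ∑' i, A.indicator (fun i => volume (closedBall (p i) (3 * u i))) i := 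
      tsum_subtype A (fun i => volume (closedBall (p i) (3 * u i)))
    _ = ∑' i, ENNReal.ofReal (A.indicator (fun i => 6 * u i) i) := by
      congr 1
      ext i
      by_cases hi : i ∈ A
      · rw [indicator_of_mem hi, indicator_of_mem hi, Real.volume_closedBall]
        congr 1
        ring
      · simp [indicator_of_notMem hi]
    _ = ENNReal.ofReal (∑' i, A.indicator (fun i => 6 * u i) i) :=
      (ENNReal.ofReal_tsum_of_nonneg hnn hS').symm
    _ ≤ ENNReal.ofReal (r / 16) := by
      refine ENNReal.ofReal_le_ofReal ?_
      refine (hS'.tsum_le_tsum hterm hS).trans ?_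
      rw [tsum_mul_left]
      have h0 : (0 : ℝ) < r / 96 := by positivity
      have h1 := mul_le_mul_of_nonneg_left hΦ
        (by positivity : (0 : ℝ) ≤ 6 * (r / 96) ^ (1 - s))
      have h2 : (r / 96) ^ (1 - s) * (r / 96) ^ s = r / 96 := by
        rw [← Real.rpow_add h0]; simp
      calc _ ≤ 6 * (r / 96) ^ (1 - s) * (r / 96) ^ s := h1
        _ = 6 * (r / 96) := by rw [mul_assoc, h2]
        _ = r / 16 := by ring

/-- If many points of `[b - r, b + r]` lie in much smaller balls, then one of those balls inherits
the smallness of the cover. -/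
theorem exists_coverMass_le {s M b r : ℝ} (hs0 : 0 < s) (hs1 : s < 1) (hM0 : 0 < M)
    (hM : 640 ≤ M ^ (1 - s)) (hr : 0 < r) {p u : ℕ → ℝ} (hu : ∀ i, 0 < u i)
    (hsum : Summable fun i => u i ^ s) (hΦ : coverMass s p u b r ≤ (r / 96) ^ s)
    {R : Set ℝ} (hR : ENNReal.ofReal (r / 8) ≤ volume R) {c ρ : ℝ → ℝ}
    (hpos : ∀ t ∈ R, 0 < ρ t) (hle : ∀ t ∈ R, ρ t ≤ r / M) (hmem : ∀ t ∈ R, |t - c t| ≤ ρ t)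
    (hsub : ∀ t ∈ R, |c t - b| + ρ t ≤ r) :
    ∃ t ∈ R, coverMass s p u (c t) (ρ t) ≤ (ρ t / 96) ^ s := by
  classical
  by_contra! H
  have hr96 : (0 : ℝ) < r / 96 := by positivity
  have hule : ∀ i, |p i - b| ≤ r + u i → u i ≤ r / 96 :=
    fun i hi => le_of_coverMass_le hs0 hu hsum hr96.le hΦ hi
  set A := {i | |p i - b| ≤ r + u i} with hA
  -- Discard the points within 3uᵢ of pᵢ: a ball attached to a remaining point that meets the i-th
  -- interval has radius at least uᵢ, as the counting lemma requires.
  set D := ⋃ i ∈ A, closedBall (p i) (3 * u i) with hD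
  have hvD : volume D ≤ ENNReal.ofReal (r / 16) := volume_biUnion_cover_le hs1 hr hu hsum hule hΦ
  have hvR : ENNReal.ofReal (10 * (r / 320)) < volume (R \ D) := by
    have h1 : ENNReal.ofReal (r / 16) ≤ volume (R \ D) := by
      calc ENNReal.ofReal (r / 16) = ENNReal.ofReal (r / 8) - ENNReal.ofReal (r / 16) := by
            rw [← ENNReal.ofReal_sub _ (by positivity)]; congr 1; ring
        _ ≤ volume R - volume D := tsub_le_tsub hR hvD
        _ ≤ volume (R \ D) := le_measure_sdiff
    refine lt_of_lt_of_le ?_ h1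
    rw [ENNReal.ofReal_lt_ofReal_iff (by positivity)]
    linarith
  obtain ⟨F, hFR, hFd, hFm⟩ := exists_finset_pairwiseDisjoint_closedBall (c := c) (ρ := ρ)
    (fun t ht => hpos t ht.1) (fun t ht => hle t ht.1) (fun t ht => hmem t ht.1) hvR
  have hpoint : ∀ i, ∑ t ∈ F, {i | |p i - c t| ≤ ρ t + u i}.indicator (fun i => u i ^ s) i ≤
      2 * A.indicator (fun i => u i ^ s) i := by
    intro i
    by_cases hi : i ∈ A
    · have hcard := card_filter_meets_le_two (F := F) (p := p i) (u := u i) hFd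
        (fun t ht hti => by
          by_contra! hlt
          refine (hFR ht).2 (mem_iUnion₂.2 ⟨i, hi, ?_⟩)
          have h1 := hmem t (hFR ht).1
          rw [mem_closedBall, Real.dist_eq]
          rw [abs_le] at *
          constructor <;> linarith)
      have e : ∑ t ∈ F, {i | |p i - c t| ≤ ρ t + u i}.indicator (fun i => u i ^ s) i =
          (F.filter fun t => |p i - c t| ≤ ρ t + u i).card * u i ^ s := by
        rw [← nsmul_eq_mul, ← Finset.sum_const, Finset.sum_filter]
        refine Finset.sum_congr rfl fun t _ => ?_
        simp only [indicator_apply, mem_ofPred_eq]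
      rw [e, indicator_of_mem hi]
      exact mul_le_mul_of_nonneg_right (by exact_mod_cast hcard) (Real.rpow_nonneg (hu i).le s)
    · rw [indicator_of_notMem hi, mul_zero]
      refine (Finset.sum_eq_zero fun t ht => indicator_of_notMem (fun hti => hi ?_) _).le
      have h1 := hsub t (hFR ht).1
      have h2 : |p i - b| ≤ |p i - c t| + |c t - b| := abs_sub_le _ _ _
      simp only [mem_ofPred_eq] at hti
      simp only [hA, mem_ofPred_eq]
      linarith
  have hupper : ∑ t ∈ F, coverMass s p u (c t) (ρ t) ≤ 2 * (r / 96) ^ s := by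
    unfold coverMass
    rw [← Summable.tsum_finsetSum (fun t _ => summable_coverMass hsum _ _)]
    refine (Summable.tsum_le_tsum hpoint
      (summable_sum fun t _ => summable_coverMass hsum _ _)
      ((summable_coverMass hsum b r).mul_left 2)).trans ?_
    rw [tsum_mul_left]
    exact mul_le_mul_of_nonneg_left hΦ (by norm_num)
  -- Since s < 1, small balls carry more s-mass per unit length: ρ ≤ r/M gains the factor M^(1-s) ≥
  -- 640. With total radius above r/320 this exceeds 2(r/96)^s, contradicting `hupper`.
  have hlower : ∀ t ∈ F, ρ t * (M ^ (1 - s) * r ^ s / r * (1 / 96) ^ s) ≤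
      coverMass s p u (c t) (ρ t) := by
    intro t ht
    have htR := (hFR ht).1
    refine le_trans ?_ (H t htR).le
    have hρ := hpos t htR
    have h1 : (r / M) ^ (s - 1) ≤ ρ t ^ (s - 1) :=
      Real.rpow_le_rpow_of_nonpos hρ (hle t htR) (by linarith)
    have h2 : ρ t ^ s = ρ t * ρ t ^ (s - 1) := by
      rw [Real.rpow_sub_one hρ.ne']; field_simp
    have h3 : (r / M) ^ (s - 1) = M ^ (1 - s) * r ^ s / r := by
      rw [Real.div_rpow hr.le hM0.le, Real.rpow_sub_one hr.ne', show s - 1 = -(1 - s) by ring,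
        Real.rpow_neg hM0.le]
      field_simp
    rw [div_eq_mul_one_div (ρ t), Real.mul_rpow hρ.le (by norm_num), h2, ← h3, ← mul_assoc]
    gcongr
  have hfin := (Finset.sum_le_sum hlower).trans hupper
  rw [← Finset.sum_mul, div_eq_mul_one_div r, Real.mul_rpow hr.le (by norm_num)] at hfin
  have hrs : 0 < r ^ s := Real.rpow_pos_of_pos hr s
  have h96 : (0 : ℝ) < (1 / 96) ^ s := by positivity
  have hX : 640 * (r ^ s / r * (1 / 96) ^ s) ≤ M ^ (1 - s) * r ^ s / r * (1 / 96) ^ s := by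
    rw [mul_div_assoc, mul_assoc]
    exact mul_le_mul_of_nonneg_right hM (by positivity)
  have hX0 : 0 < r ^ s / r * (1 / 96) ^ s := by positivity
  have h4 : r / 320 * (640 * (r ^ s / r * (1 / 96) ^ s)) <
      (∑ t ∈ F, ρ t) * (M ^ (1 - s) * r ^ s / r * (1 / 96) ^ s) :=
    mul_lt_mul hFm hX (by positivity) (Finset.sum_nonneg fun t ht => (hpos t (hFR ht).1).le)
  have h5 : r / 320 * (640 * (r ^ s / r * (1 / 96) ^ s)) = 2 * (r ^ s * (1 / 96) ^ s) := by
    field_simp; norm_num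
  linarith

/-! ### Supremal convolutions and contact points -/

/-- The supremal convolution of `g` on `[-r, r]` with the cone `-N |x|`. -/
theorem exists_supConvolution {g : ℝ → ℝ} (hg : Continuous g) {r : ℝ} (hr : 0 ≤ r) (N : NNReal) :
    ∃ h : ℝ → ℝ, LipschitzWith N h ∧
      (∀ t, ∃ u ∈ Icc (-r) r, h t = g u - N * |u - t|) ∧
      ∀ t, ∀ w ∈ Icc (-r) r, g w - N * |w - t| ≤ h t := by
  have hmax : ∀ t, ∃ u ∈ Icc (-r) r, IsMaxOn (fun w => g w - N * |w - t|) (Icc (-r) r) u :=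
    fun t => isCompact_Icc.exists_isMaxOn ⟨0, by constructor <;> linarith⟩ (by fun_prop)
  choose m hm hmax using hmax
  have hle : ∀ t, ∀ w ∈ Icc (-r) r, g w - N * |w - t| ≤ g (m t) - N * |m t - t| :=
    fun t w hw => isMaxOn_iff.1 (hmax t) w hw
  refine ⟨fun t => g (m t) - N * |m t - t|, ?_, fun t => ⟨m t, hm t, rfl⟩, hle⟩
  refine LipschitzWith.of_le_add_mul N fun x y => ?_
  have h1 := hle y (m x) (hm x)
  have h2 : |m x - y| ≤ |m x - x| + |x - y| := abs_sub_le _ _ _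
  have h3 := mul_le_mul_of_nonneg_left h2 N.2
  rw [Real.dist_eq]
  change _ ≤ _ at h3
  simp only [NNReal.val_eq_coe] at h3
  linarith

theorem volume_image_le_of_lipschitzWith {K : NNReal} {f : ℝ → ℝ} (hf : LipschitzWith K f)
    (s : Set ℝ) : volume (f '' s) ≤ K * volume s := by
  have := hf.hausdorffMeasure_image_le (d := 1) zero_le_one s
  rwa [hausdorffMeasure_real, ENNReal.rpow_one] at this

/-- If the contact set with the supremal convolution is null, then the points that see their
contact point on the right have a definite measure. -/
theorem le_volume_setOf_contact_right {g : ℝ → ℝ} (hg : Continuous g) {r C N : ℝ} (hr : 0 < r)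
    (hC : 0 < C) (hN : 2 * C ≤ N) (hup : ∀ x, |x| ≤ r → g x ≤ 0)
    (hlow : ∀ x, |x| ≤ r → -C * |x| ≤ g x)
    (hnull : volume {t | t ∈ Icc (-r) r ∧ ∀ w ∈ Icc (-r) r, g w ≤ g t + N * |w - t|} = 0) :
    ENNReal.ofReal (r / 8) ≤ volume {t | t ∈ Icc 0 (r / 2) ∧ ∃ u, t < u ∧ u ≤ r ∧
      ∀ w ∈ Icc (-r) r, g w - N * |w - t| ≤ g u - N * (u - t)} := by
  have hN0 : 0 < N := by linarith
  lift N to NNReal using hN0.le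
  set K := {t | t ∈ Icc (-r) r ∧ ∀ w ∈ Icc (-r) r, g w ≤ g t + N * |w - t|} with hK
  set R := {t | t ∈ Icc 0 (r / 2) ∧ ∃ u, t < u ∧ u ≤ r ∧
      ∀ w ∈ Icc (-r) r, g w - N * |w - t| ≤ g u - N * (u - t)} with hRdef
  obtain ⟨h, hlip, hatt, hmax⟩ := exists_supConvolution hg hr.le N
  -- Adding N t makes the N-Lipschitz function h nondecreasing. Where the contact point is on the
  -- left, ψ is locally constant to the left of t, so such t contribute only countably many values.
  set ψ : ℝ → ℝ := fun t => h t + N * t with hψ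
  have hψlip : LipschitzWith (2 * N) ψ := by
    have h1 : LipschitzWith N (fun t : ℝ => (N : ℝ) * t) :=
      LipschitzWith.of_dist_le_mul fun x y => by
        rw [Real.dist_eq, Real.dist_eq, ← mul_sub, abs_mul, NNReal.abs_eq]
    have := hlip.add h1
    rwa [← two_mul] at this
  have hmono : Monotone ψ := by
    intro x y hxy
    have := hlip.dist_le_mul x y
    rw [Real.dist_eq, Real.dist_eq, abs_sub_comm x y, abs_of_nonneg (sub_nonneg.2 hxy)] at this
    have := (abs_le.1 this).2
    simp only [hψ]
    linarith
  have hcover : Icc (ψ 0) (ψ (r / 2)) ⊆ ψ '' K ∪ range (fun q : ℚ => ψ q) ∪ ψ '' R := by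
    intro y hy
    obtain ⟨t, ht, rfl⟩ := intermediate_value_Icc (by positivity : (0 : ℝ) ≤ r / 2)
      hψlip.continuous.continuousOn hy
    have htI : t ∈ Icc (-r) r := ⟨by linarith [ht.1], by linarith [ht.2]⟩
    obtain ⟨u, hu, htu⟩ := hatt t
    rcases lt_trichotomy u t with hlt | rfl | hgt
    · obtain ⟨q, hq1, hq2⟩ := exists_rat_btwn hlt
      refine Or.inl (Or.inr ⟨q, le_antisymm (hmono hq2.le) ?_⟩)
      have h1 := hmax q u hu
      rw [abs_sub_comm, abs_of_pos (sub_pos.2 hq1)] at h1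
      rw [abs_sub_comm, abs_of_pos (sub_pos.2 hlt)] at htu
      simp only [hψ]
      linarith
    · refine Or.inl (Or.inl ⟨u, ⟨htI, fun w hw => ?_⟩, rfl⟩)
      have h1 := hmax u w hw
      simp only [sub_self, abs_zero, mul_zero, sub_zero] at htu
      linarith
    · refine Or.inr ⟨t, ⟨ht, u, hgt, hu.2, fun w hw => ?_⟩, rfl⟩
      rw [abs_of_pos (sub_pos.2 hgt)] at htu
      exact (hmax t w hw).trans htu.le
  -- Here h(0) ≤ 0 and h(r/2) ≥ -C r/2 ≥ -N r/4. As ψ is 2N-Lipschitz, the rise N r/4 forces measure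
  -- at least r/8.
  have hlen : N * r / 4 ≤ ψ (r / 2) - ψ 0 := by
    have h1 := hmax (r / 2) (r / 2) ⟨by linarith, by linarith⟩
    have h2 := hlow (r / 2) (by rw [abs_of_pos] <;> linarith)
    obtain ⟨u, hu, h0⟩ := hatt 0
    have h3 := hup u (abs_le.2 hu)
    have h4 : (0 : ℝ) ≤ N * |u - 0| := by positivity
    rw [abs_of_pos (by positivity : (0 : ℝ) < r / 2)] at h2
    simp only [sub_self, abs_zero, mul_zero, sub_zero] at h1
    simp only [hψ]
    nlinarith
  have hvK : volume (ψ '' K) = 0 := by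
    have := volume_image_le_of_lipschitzWith hψlip K
    rwa [hnull, mul_zero, nonpos_iff_eq_zero] at this
  have hvQ : volume (range fun q : ℚ => ψ q) = 0 := (countable_range _).measure_zero _
  have hvR := volume_image_le_of_lipschitzWith hψlip R
  have hfin : ENNReal.ofReal (N * r / 4) ≤ (2 * N : NNReal) * volume R := by
    calc ENNReal.ofReal (N * r / 4) ≤ volume (Icc (ψ 0) (ψ (r / 2))) := by
          rw [Real.volume_Icc]; exact ENNReal.ofReal_le_ofReal hlen
      _ ≤ volume (ψ '' K) + volume (range fun q : ℚ => ψ q) + volume (ψ '' R) :=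
          (measure_mono hcover).trans
            ((measure_union_le _ _).trans (add_le_add_left (measure_union_le _ _) _))
      _ ≤ _ := by rw [hvK, hvQ, zero_add, zero_add]; exact hvR
  have hN2 : ((2 * N : NNReal) : ENNReal) ≠ 0 := by
    have : N ≠ 0 := fun h => by simp [h] at hN0
    simpa using this
  refine (ENNReal.mul_le_mul_iff_right hN2 ENNReal.coe_ne_top).1 (le_trans (le_of_eq ?_) hfin)
  rw [← ENNReal.ofReal_coe_nnreal, ← ENNReal.ofReal_mul (by positivity)]
  congr 1
  push_cast
  ring

/-! ### Nearly affine intervals and changes of slope -/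

/-- One-sided Zygmund condition with constant `C` up to scale `δ`. -/
def LowerZygmund (F : ℝ → ℝ) (C δ : ℝ) : Prop :=
  ∀ t s, 0 ≤ s → s ≤ δ → 2 * F t - C * s ≤ F (t + s) + F (t - s)

theorem LowerZygmund.mono {F : ℝ → ℝ} {C C' δ δ' : ℝ} (h : LowerZygmund F C δ) (hC : C ≤ C')
    (hδ : δ' ≤ δ) : LowerZygmund F C' δ' := by
  intro t s hs hsδ
  have := h t s hs (hsδ.trans hδ)
  nlinarith

theorem LowerZygmund.comp_neg {F : ℝ → ℝ} {C δ : ℝ} (h : LowerZygmund F C δ) :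
    LowerZygmund (fun x => F (-x)) C δ := by
  intro t s hs hsδ
  have := h (-t) s hs hsδ
  beta_reduce
  rw [show -(t + s) = -t - s by ring, show -(t - s) = -t + s by ring]
  linarith

/-- On `[b - r, b + r]`, the function `F` lies below its tangent of slope `σ` at `b`, by at most
`C` times the distance to `b`. -/
def NearlyAffine (F : ℝ → ℝ) (b r σ C : ℝ) : Prop :=
  ∀ s, |s| ≤ r → F (b + s) ≤ F b + σ * s ∧ F b + σ * s - C * |s| ≤ F (b + s)

theorem NearlyAffine.comp_neg {F : ℝ → ℝ} {b r σ C : ℝ} (h : NearlyAffine F b r σ C) :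
    NearlyAffine (fun x => F (-x)) (-b) r (-σ) C := by
  intro s hs
  have := h (-s) (by rwa [abs_neg])
  rw [abs_neg] at this
  beta_reduce
  rw [show -(-b + s) = b + -s by ring, neg_neg]
  constructor <;> linarith

/-- The lower bound in `NearlyAffine` follows from the upper one and the Zygmund condition. -/
theorem NearlyAffine.of_upper {F : ℝ → ℝ} {b r σ C : ℝ} (hZ : LowerZygmund F C r)
    (h : ∀ s, |s| ≤ r → F (b + s) ≤ F b + σ * s) : NearlyAffine F b r σ C := by
  intro s hs
  refine ⟨h s hs, ?_⟩
  have h1 := hZ b |s| (abs_nonneg s) hs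
  have h2 := h (-s) (by rwa [abs_neg])
  rcases abs_cases s with ⟨e, _⟩ | ⟨e, _⟩
  · rw [e] at h1 ⊢
    rw [← sub_eq_add_neg] at h2
    linarith
  · rw [e] at h1 ⊢
    rw [sub_neg_eq_add] at h1
    linarith

/-- The points of `[b - r, b + r]` where the graph of `F` touches from below a cone with slopes
`σ - N` and `σ + N`. -/
def coneContact (F : ℝ → ℝ) (b r σ N : ℝ) : Set ℝ :=
  {x | |x - b| ≤ r ∧ ∀ y, |y - b| ≤ r → F y ≤ F x + σ * (y - x) + N * |y - x|}

theorem coneContact_comp_neg (F : ℝ → ℝ) (b r σ N : ℝ) :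
    coneContact (fun x => F (-x)) (-b) r (-σ) N = Neg.neg ⁻¹' coneContact F b r σ N := by
  have e : ∀ x : ℝ, |x - -b| = |-x - b| := fun x => by rw [← abs_neg]; congr 1; ring
  ext x
  simp only [coneContact, mem_preimage, mem_ofPred_eq, e]
  refine and_congr Iff.rfl ⟨fun h y hy => ?_, fun h y hy => ?_⟩
  · have := h (-y) (by rwa [neg_neg])
    rw [neg_neg] at this
    rw [show |y - -x| = |-y - x| by rw [← abs_neg]; congr 1; ring]
    linarith
  · have := h (-y) hy
    rw [show |-y - -x| = |y - x| by rw [← abs_neg]; congr 1; ring] at this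
    linarith

theorem volume_coneContact_comp_neg (F : ℝ → ℝ) (b r σ N : ℝ) :
    volume (coneContact (fun x => F (-x)) (-b) r (-σ) N) = volume (coneContact F b r σ N) := by
  rw [coneContact_comp_neg]
  exact Measure.measure_preimage_neg volume _

/-- Passing from a nearly affine interval to a much smaller one, on which the slope has increased by
`N`, while keeping the cover light. -/
theorem NearlyAffine.exists_add {F : ℝ → ℝ} (hF : Continuous F) {b r σ C C' M s : ℝ}
    (hs0 : 0 < s) (hs1 : s < 1) (hM8 : 8 ≤ M) (hM : 640 ≤ M ^ (1 - s)) (hr : 0 < r) (hC : 0 < C)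
    {p u : ℕ → ℝ} (hu : ∀ i, 0 < u i) (hsum : Summable fun i => u i ^ s)
    (hΦ : coverMass s p u b r ≤ (r / 96) ^ s) (hA : NearlyAffine F b r σ C)
    (hZ : LowerZygmund F C' (r / 8)) (hnull : volume (coneContact F b r σ (M * C)) = 0) :
    ∃ b' r', 0 < r' ∧ r' ≤ r / 8 ∧ |b' - b| + r' ≤ 3 * r / 4 ∧
      b' ∈ coneContact F b r σ (M * C) ∧ NearlyAffine F b' r' (σ + M * C) C' ∧
      coverMass s p u b' r' ≤ (r' / 96) ^ s := by
  have hM0 : 0 < M := by linarith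
  set N := M * C with hN
  have hN0 : 0 < N := by positivity
  set g : ℝ → ℝ := fun x => F (b + x) - F b - σ * x with hg
  have hgc : Continuous g := by fun_prop
  have hup : ∀ x, |x| ≤ r → g x ≤ 0 := fun x hx => by
    have := (hA x hx).1; simp only [hg]; linarith
  have hlow : ∀ x, |x| ≤ r → -C * |x| ≤ g x := fun x hx => by
    have := (hA x hx).2; simp only [hg]; linarith
  have hcontact : ∀ t, (t ∈ Icc (-r) r ∧ ∀ w ∈ Icc (-r) r, g w ≤ g t + N * |w - t|) ↔
      b + t ∈ coneContact F b r σ N := by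
    intro t
    simp only [coneContact, mem_ofPred_eq, add_sub_cancel_left, abs_le, mem_Icc]
    refine and_congr Iff.rfl ⟨fun h y hy => ?_, fun h w hw => ?_⟩
    · have := h (y - b) hy
      simp only [hg] at this
      rw [show b + (y - b) = y by ring, show y - b - t = y - (b + t) by ring] at this
      linarith
    · have := h (b + w) (by simpa using hw)
      rw [show b + w - (b + t) = w - t by ring] at this
      simp only [hg]
      linarith
  have hnull' : volume {t | t ∈ Icc (-r) r ∧ ∀ w ∈ Icc (-r) r, g w ≤ g t + N * |w - t|} = 0 := by
    rw [show {t | t ∈ Icc (-r) r ∧ ∀ w ∈ Icc (-r) r, g w ≤ g t + N * |w - t|} =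
      (fun t => b + t) ⁻¹' coneContact F b r σ N from Set.ext hcontact, measure_preimage_add]
    exact hnull
  have hR := le_volume_setOf_contact_right hgc hr hC (by nlinarith : 2 * C ≤ N) hup hlow hnull'
  set R := {t | t ∈ Icc 0 (r / 2) ∧ ∃ u, t < u ∧ u ≤ r ∧
      ∀ w ∈ Icc (-r) r, g w - N * |w - t| ≤ g u - N * (u - t)} with hRdef
  have hch : ∀ t, ∃ v, t ∈ R → t < v ∧ v ≤ r ∧
      ∀ w ∈ Icc (-r) r, g w - N * |w - t| ≤ g v - N * (v - t) := by
    intro t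
    by_cases ht : t ∈ R
    · obtain ⟨v, hv⟩ := ht.2
      exact ⟨v, fun _ => hv⟩
    · exact ⟨0, fun h => absurd h ht⟩
  choose v hv using hch
  -- Comparing the contact point with t itself gives N (v t - t) ≤ g(v t) - g(t) ≤ C t, and N = M C.
  have hvle : ∀ t ∈ R, v t - t ≤ r / M := by
    intro t ht
    obtain ⟨h1, h2, h3⟩ := hv t ht
    have h0 := ht.1.1
    have h0' := ht.1.2
    have h4 := h3 t ⟨by linarith, by linarith⟩
    have h5 := hup (v t) (abs_le.2 ⟨by linarith, h2⟩)
    have h6 := hlow t (abs_le.2 ⟨by linarith, by linarith⟩)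
    rw [abs_of_nonneg h0] at h6
    simp only [sub_self, abs_zero, mul_zero, sub_zero] at h4
    rw [le_div_iff₀ hM0]
    have h7 : C * (M * (v t - t)) ≤ C * r := by
      have : N * (v t - t) ≤ C * t := by linarith
      calc C * (M * (v t - t)) = N * (v t - t) := by rw [hN]; ring
        _ ≤ C * t := this
        _ ≤ C * r := by gcongr; linarith
    have := le_of_mul_le_mul_left h7 hC
    linarith
  have hrM : r / M ≤ r / 8 := by gcongr
  have hR' : ENNReal.ofReal (r / 8) ≤ volume ((fun x => -b + x) ⁻¹' R) := by
    rwa [measure_preimage_add]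
  obtain ⟨x, hx, hxΦ⟩ := exists_coverMass_le hs0 hs1 hM0 hM hr hu hsum hΦ hR'
    (c := fun x => b + v (-b + x)) (ρ := fun x => v (-b + x) - (-b + x))
    (fun t ht => by have := (hv _ ht).1; linarith) (fun t ht => hvle _ ht)
    (fun t ht => by
      have := (hv _ ht).1
      rw [abs_le]
      constructor <;> linarith)
    (fun t ht => by
      have h1 := hvle _ ht
      have h2 := (hv _ ht).1
      have h3 := ht.1.1
      have h4 := ht.1.2
      rw [add_sub_cancel_left, abs_of_nonneg] <;> linarith)
  set t := -b + x with htx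
  have ht : t ∈ R := hx
  obtain ⟨h1, h2, h3⟩ := hv t ht
  have h4 := ht.1.1
  have h5 := ht.1.2
  have h6 := hvle t ht
  set b' := v t
  have hbc : b + b' ∈ coneContact F b r σ N := by
    refine (hcontact b').1 ⟨⟨by linarith, h2⟩, fun w hw => ?_⟩
    have h7 := h3 w hw
    have h8 : |w - t| ≤ |w - b'| + |b' - t| := abs_sub_le _ _ _
    rw [abs_of_pos (sub_pos.2 h1)] at h8
    have := mul_le_mul_of_nonneg_left h8 hN0.le
    linarith
  refine ⟨b + b', b' - t, by linarith, by linarith, ?_, hbc, ?_, hxΦ⟩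
  · rw [add_sub_cancel_left, abs_of_nonneg] <;> linarith
  -- The line of slope σ + N bounds F to the right of the new centre because it is a contact point,
  -- and to the left, down to t, because it is optimal for t. This is why the new radius is b' - t.
  · refine NearlyAffine.of_upper (hZ.mono le_rfl (by linarith)) fun a ha => ?_
    rw [abs_le] at ha
    rcases le_total 0 a with h0 | h0
    · have h7 := hbc.2 (b + b' + a) (by rw [abs_le]; constructor <;> linarith)
      rw [add_sub_cancel_left, abs_of_nonneg h0] at h7
      linarith
    · have h7 := h3 (b' + a) ⟨by linarith, by linarith⟩
      rw [abs_of_nonneg (by linarith : 0 ≤ b' + a - t)] at h7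
      simp only [hg] at h7
      rw [← add_assoc] at h7
      linarith

/-- Mirror image of `NearlyAffine.exists_add` under x ↦ -x. -/
theorem NearlyAffine.exists_sub {F : ℝ → ℝ} (hF : Continuous F) {b r σ C C' M s : ℝ}
    (hs0 : 0 < s) (hs1 : s < 1) (hM8 : 8 ≤ M) (hM : 640 ≤ M ^ (1 - s)) (hr : 0 < r) (hC : 0 < C)
    {p u : ℕ → ℝ} (hu : ∀ i, 0 < u i) (hsum : Summable fun i => u i ^ s)
    (hΦ : coverMass s p u b r ≤ (r / 96) ^ s) (hA : NearlyAffine F b r σ C)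
    (hZ : LowerZygmund F C' (r / 8)) (hnull : volume (coneContact F b r σ (M * C)) = 0) :
    ∃ b' r', 0 < r' ∧ r' ≤ r / 8 ∧ |b' - b| + r' ≤ 3 * r / 4 ∧
      b' ∈ coneContact F b r σ (M * C) ∧ NearlyAffine F b' r' (σ - M * C) C' ∧
      coverMass s p u b' r' ≤ (r' / 96) ^ s := by
  obtain ⟨b', r', h1, h2, h3, h4, h5, h6⟩ := NearlyAffine.exists_add (F := fun x => F (-x))
    (hF.comp continuous_neg) hs0 hs1 hM8 hM hr hC hu hsum (p := fun i => -p i) (b := -b)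
    (σ := -σ) (by rwa [coverMass_neg]) hA.comp_neg hZ.comp_neg
    (by rwa [volume_coneContact_comp_neg])
  refine ⟨-b', r', h1, h2, ?_, ?_, ?_, ?_⟩
  · rwa [show -b' - b = -(b' - -b) by ring, abs_neg]
  · rw [coneContact_comp_neg] at h4
    exact h4
  · have := h5.comp_neg
    simp only [neg_neg] at this
    rwa [show -(-σ + M * C) = σ - M * C by ring] at this
  · rw [← coverMass_neg, neg_neg]
    exact h6

/-! ### Nested intervals escaping a light cover -/

theorem exists_cover_of_dimH_lt_one {E : Set ℝ} (hE : dimH E < 1) :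
    ∃ s : ℝ, 0 < s ∧ s < 1 ∧ ∀ η : ℝ, 0 < η → ∃ p u : ℕ → ℝ, (∀ i, 0 < u i) ∧
      (Summable fun i => u i ^ s) ∧ ∑' i, u i ^ s ≤ η ∧ ∀ t ∈ E, ∃ i, |p i - t| ≤ u i := by
  obtain ⟨s, hEs, hs1⟩ := ENNReal.lt_iff_exists_nnreal_btwn.1 hE
  have hs0 : 0 < (s : ℝ) := by
    have : (0 : ENNReal) < s := bot_le.trans_lt hEs
    exact_mod_cast this
  have hs1' : (s : ℝ) < 1 := by exact_mod_cast hs1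
  refine ⟨s, hs0, hs1', fun η hη => ?_⟩
  have h0 := hausdorffMeasure_of_dimH_lt hEs
  rw [Measure.hausdorffMeasure_apply] at h0
  have h1 : (⨅ (t : ℕ → Set ℝ) (_ : E ⊆ ⋃ n, t n) (_ : ∀ n, ediam (t n) ≤ 1),
      ∑' n, ⨆ _ : (t n).Nonempty, ediam (t n) ^ (s : ℝ)) < ENNReal.ofReal (η / 2) := by
    refine lt_of_le_of_lt ?_ (ENNReal.ofReal_pos.2 (half_pos hη))
    rw [← h0]
    exact le_iSup₂ (f := fun (r : ENNReal) (_ : 0 < r) => ⨅ (t : ℕ → Set ℝ)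
      (_ : E ⊆ ⋃ n, t n) (_ : ∀ n, ediam (t n) ≤ r),
      ∑' n, ⨆ _ : (t n).Nonempty, ediam (t n) ^ (s : ℝ)) 1 one_pos
  simp only [iInf_lt_iff] at h1
  obtain ⟨t, hcov, hdiam, hlt⟩ := h1
  have hsup : ∀ n, (⨆ _ : (t n).Nonempty, ediam (t n) ^ (s : ℝ)) = ediam (t n) ^ (s : ℝ) := by
    intro n
    rcases (t n).eq_empty_or_nonempty with h | h
    · simp [h, ENNReal.zero_rpow_of_pos hs0]
    · simp [h]
  simp only [hsup] at hlt
  set a : ℕ → ENNReal := fun n => ediam (t n) ^ (s : ℝ) with ha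
  have hne : ∑' n, a n ≠ ⊤ := (hlt.trans ENNReal.ofReal_lt_top).ne
  have hsa : Summable fun n => (a n).toReal := ENNReal.summable_toReal hne
  have hta : ∑' n, (a n).toReal ≤ η / 2 := by
    rw [← ENNReal.tsum_toReal_eq (fun n => ENNReal.ne_top_of_tsum_ne_top hne n)]
    exact ENNReal.toReal_le_of_le_ofReal (by positivity) hlt.le
  -- A geometric padding of total mass η/2 makes all radii positive, even for covering sets of
  -- diameter 0.
  have hsg : Summable fun n : ℕ => η / 4 * (1 / 2 : ℝ) ^ n := summable_geometric_two.mul_left _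
  have hpos : ∀ n, 0 < (a n).toReal + η / 4 * (1 / 2 : ℝ) ^ n := fun n => by positivity
  have hpow : ∀ n, (((a n).toReal + η / 4 * (1 / 2 : ℝ) ^ n) ^ (1 / (s : ℝ))) ^ (s : ℝ) =
      (a n).toReal + η / 4 * (1 / 2 : ℝ) ^ n := fun n => by
    rw [← Real.rpow_mul (hpos n).le, one_div_mul_cancel hs0.ne', Real.rpow_one]
  have hp : ∀ n, ∃ x, (t n).Nonempty → x ∈ t n := fun n => by
    by_cases h : (t n).Nonempty
    · exact ⟨h.some, fun _ => h.some_mem⟩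
    · exact ⟨0, fun h' => absurd h' h⟩
  choose p hp using hp
  refine ⟨p, fun n => ((a n).toReal + η / 4 * (1 / 2 : ℝ) ^ n) ^ (1 / (s : ℝ)),
    fun n => Real.rpow_pos_of_pos (hpos n) _, ?_, ?_, fun x hx => ?_⟩
  · simp only [hpow]
    exact hsa.add hsg
  · simp only [hpow]
    rw [hsa.tsum_add hsg, tsum_mul_left, tsum_geometric_two]
    linarith
  · obtain ⟨n, hn⟩ := mem_iUnion.1 (hcov hx)
    refine ⟨n, ?_⟩
    have h2 : edist (p n) x ≤ ediam (t n) := edist_le_ediam_of_mem (hp n ⟨x, hn⟩) hn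
    have h3 : ENNReal.ofReal |p n - x| ^ (s : ℝ) ≤ a n := by
      rw [← Real.dist_eq, ← edist_dist]
      exact ENNReal.rpow_le_rpow h2 hs0.le
    rw [ENNReal.ofReal_rpow_of_nonneg (abs_nonneg _) hs0.le,
      ENNReal.ofReal_le_iff_le_toReal (ENNReal.ne_top_of_tsum_ne_top hne n)] at h3
    refine (Real.rpow_le_rpow_iff (abs_nonneg _) (Real.rpow_nonneg (hpos n).le _) hs0).1 ?_
    rw [hpow]
    have : 0 ≤ η / 4 * (1 / 2 : ℝ) ^ n := by positivity
    linarith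

/-- Zygmund constants at geometric scales that decrease slowly, and to `0` when possible. -/
theorem exists_zygmund_constants {F : ℝ → ℝ} {C r : ℝ} (hC : 0 < C) (hr : 0 < r)
    (hZ : LowerZygmund F C r) :
    ∃ c : ℕ → ℝ, c 0 = C ∧ (∀ k, 0 < c k) ∧ Antitone c ∧ (∀ k, c k ≤ 2 * c (k + 1)) ∧
      (∀ k, LowerZygmund F (c k) (r / 8 ^ k)) ∧
      ((∀ ε > 0, ∃ δ > 0, LowerZygmund F ε δ) → Tendsto c atTop (𝓝 0)) := by
  classical
  -- Halve the constant whenever the Zygmund condition at the next scale permits it, and keep it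
  -- otherwise.
  set c : ℕ → ℝ := fun k => Nat.rec C
    (fun k x => if LowerZygmund F (x / 2) (r / 8 ^ (k + 1)) then x / 2 else x) k with hc
  have h0 : c 0 = C := rfl
  have hsucc : ∀ k, c (k + 1) =
    if LowerZygmund F (c k / 2) (r / 8 ^ (k + 1)) then c k / 2 else c k := fun k => rfl
  have hpos : ∀ k, 0 < c k := by
    intro k
    induction k with
    | zero => exact hC
    | succ k ih => rw [hsucc]; split_ifs <;> linarith
  have hanti : Antitone c := antitone_nat_of_succ_le fun k => by
    have := hpos k
    rw [hsucc]; split_ifs <;> linarith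
  have hZk : ∀ k, LowerZygmund F (c k) (r / 8 ^ k) := by
    intro k
    induction k with
    | zero => simpa [h0] using hZ
    | succ k ih =>
      rw [hsucc]
      split_ifs with h
      · exact h
      · refine ih.mono le_rfl ?_
        rw [pow_succ]
        gcongr
        linarith [pow_pos (by norm_num : (0 : ℝ) < 8) k]
  refine ⟨c, h0, hpos, hanti, fun k => ?_, hZk, fun hsmall => ?_⟩
  · have := hpos k
    rw [hsucc]; split_ifs <;> linarith
  · have key : ∀ ε > 0, ∃ k, c k ≤ ε := by
      intro ε hε
      by_contra! H
      obtain ⟨δ, hδ, hZδ⟩ := hsmall (ε / 2) (by positivity)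
      have ht : Tendsto (fun k : ℕ => r * (1 / 8 : ℝ) ^ k) atTop (𝓝 (r * 0)) :=
        (tendsto_pow_atTop_nhds_zero_of_lt_one (by norm_num) (by norm_num)).const_mul r
      rw [mul_zero] at ht
      obtain ⟨k₀, hk₀⟩ := eventually_atTop.1 (ht.eventually_le_const hδ)
      have hhalf : ∀ n, c (k₀ + n) = c k₀ * (1 / 2) ^ n := by
        intro n
        induction n with
        | zero => simp
        | succ n ih =>
          rw [← add_assoc, hsucc, if_pos, ih, pow_succ]
          · ring
          · refine hZδ.mono (by linarith [H (k₀ + n)]) ?_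
            have := hk₀ (k₀ + n + 1) (by omega)
            rwa [one_div, inv_pow, ← div_eq_mul_inv] at this
      have ht2 : Tendsto (fun n : ℕ => c k₀ * (1 / 2 : ℝ) ^ n) atTop (𝓝 (c k₀ * 0)) :=
        (tendsto_pow_atTop_nhds_zero_of_lt_one (by norm_num) (by norm_num)).const_mul _
      rw [mul_zero] at ht2
      obtain ⟨n, hn⟩ := (ht2.eventually_le_const hε).exists
      rw [← hhalf] at hn
      exact hn.not_gt (H _)
    rw [Metric.tendsto_atTop]
    intro ε hε
    obtain ⟨k, hk⟩ := key (ε / 2) (by positivity)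
    refine ⟨k, fun n hn => ?_⟩
    rw [Real.dist_eq, sub_zero, abs_of_pos (hpos n)]
    linarith [hanti hn]

theorem eventually_le_of_scales {F : ℝ → ℝ} {t ε : ℝ} {ρ : ℕ → ℝ} (hρ : ∀ k, 0 < ρ k)
    (hρ0 : Tendsto ρ atTop (𝓝 0)) {k₀ : ℕ}
    (h : ∀ k, k₀ ≤ k → ∀ a, ρ (k + 1) ≤ |a| → |a| ≤ ρ k → F (t + a) ≤ F t + ε * |a|) :
    ∀ᶠ a in 𝓝 0, F (t + a) ≤ F t + ε * |a| := by
  classical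
  rw [Metric.eventually_nhds_iff]
  refine ⟨ρ k₀, hρ k₀, fun a ha => ?_⟩
  rw [Real.dist_eq, sub_zero] at ha
  rcases eq_or_ne a 0 with rfl | ha0
  · simp
  have hex : ∃ k, k₀ ≤ k ∧ ρ (k + 1) ≤ |a| := by
    have h1 := ((tendsto_add_atTop_iff_nat 1).2 hρ0).eventually_le_const (abs_pos.2 ha0)
    obtain ⟨k, hk, hk'⟩ := (h1.and (eventually_ge_atTop k₀)).exists
    exact ⟨k, hk', hk⟩
  obtain ⟨hk1, hk2⟩ := Nat.find_spec hex
  refine h _ hk1 a hk2 ?_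
  rcases hk1.eq_or_lt with heq | hlt
  · rw [← heq]; exact ha.le
  · obtain ⟨j, hj⟩ : ∃ j, Nat.find hex = j + 1 := ⟨Nat.find hex - 1, by omega⟩
    have := Nat.find_min hex (m := j) (by omega)
    push Not at this
    rw [hj]
    exact (this (by omega)).le

/-- The increments of `F` at a point `t` of a nearly affine interval centred at a contact point, at
scales between the radius of that interval and the one of the interval it was extracted from. -/
theorem NearlyAffine.increment_le {F : ℝ → ℝ} {b r σ N b' r' σ' C t a : ℝ} (hC : C ≤ N)
    (hσ : |σ' - σ| ≤ N) (hcontact : b' ∈ coneContact F b r σ N) (hA : NearlyAffine F b' r' σ' C)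
    (ht : |t - b'| ≤ r') (hbb : |b' - b| + r' ≤ 3 * r / 4) (ha1 : r' / 4 ≤ |a|)
    (ha2 : |a| ≤ r / 4) : F (t + a) ≤ F t + (|σ| + 13 * N) * |a| := by
  have hN : 0 ≤ N := (abs_nonneg _).trans hσ
  have h1 : |t + a - b| ≤ |a| + |t - b'| + |b' - b| := by
    rw [show t + a - b = a + (t - b') + (b' - b) by ring]
    exact abs_add_three _ _ _
  -- The contact inequality applies because t + a stays within 3r/4 + r/4 = r of b. With |t - b'| ≤
  -- 4|a|, the cone, slope and lower-bound errors add up to N|a| + 3N·4|a| = 13N|a|.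
  have h2 := hcontact.2 (t + a) (by linarith)
  have h3 := (hA (t - b') ht).2
  rw [add_sub_cancel] at h3
  have h4 : |t + a - b'| ≤ |a| + |t - b'| := by
    rw [show t + a - b' = a + (t - b') by ring]
    exact abs_add_le _ _
  have h5 : -(σ' - σ) * (t - b') ≤ N * |t - b'| := by
    refine (le_abs_self _).trans ?_
    rw [abs_mul, abs_neg]
    gcongr
  have h6 : σ * a ≤ |σ| * |a| := by
    rw [← abs_mul]; exact le_abs_self _
  have h7 := mul_le_mul_of_nonneg_left h4 hN
  have h8 : C * |t - b'| ≤ N * |t - b'| := by gcongr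
  have h9 : N * |t - b'| ≤ N * (4 * |a|) := by gcongr; linarith
  have h10 : σ * (t + a - b') = σ * a + σ * (t - b') := by ring
  linarith

/-- Unless the contact sets have positive measure, any light enough cover misses a point at which
the increments of `F` are controlled at all scales. -/
theorem exists_controlled_point_notMem_cover {F : ℝ → ℝ} (hF : Continuous F) {b₀ r₀ M s : ℝ}
    (hs0 : 0 < s) (hs1 : s < 1) (hM8 : 8 ≤ M) (hM : 640 ≤ M ^ (1 - s)) (hr₀ : 0 < r₀)
    {c : ℕ → ℝ} (hc : ∀ k, 0 < c k) (hanti : Antitone c) (hhalf : ∀ k, c k ≤ 2 * c (k + 1))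
    (hZ : ∀ k, LowerZygmund F (c k) (r₀ / 8 ^ k)) (hA : NearlyAffine F b₀ r₀ 0 (c 0))
    (hnull : ∀ b r σ N, 0 ≤ N → |b - b₀| + r ≤ r₀ → volume (coneContact F b r σ N) = 0)
    {p u : ℕ → ℝ} (hu : ∀ i, 0 < u i) (hsum : Summable fun i => u i ^ s)
    (hΦ : ∑' i, u i ^ s ≤ (r₀ / 96) ^ s) :
    ∃ t, |t - b₀| ≤ r₀ ∧ (∀ i, u i < |p i - t|) ∧ ∃ ρ : ℕ → ℝ, (∀ k, 0 < ρ k) ∧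
      Tendsto ρ atTop (𝓝 0) ∧ ∀ k a, ρ (k + 1) ≤ |a| → |a| ≤ ρ k →
        F (t + a) ≤ F t + 15 * M * c k * |a| := by
  have hM0 : 0 < M := by linarith
  set P : ℕ → ℝ × ℝ × ℝ → Prop := fun k x => 0 < x.2.1 ∧ x.2.1 ≤ r₀ / 8 ^ k ∧
    |x.1 - b₀| + x.2.1 ≤ r₀ ∧ NearlyAffine F x.1 x.2.1 x.2.2 (c k) ∧ |x.2.2| ≤ 2 * (M * c k) ∧
    coverMass s p u x.1 x.2.1 ≤ (x.2.1 / 96) ^ s with hP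
  set Q : ℕ → ℝ × ℝ × ℝ → ℝ × ℝ × ℝ → Prop := fun k x y => y.2.1 ≤ x.2.1 / 8 ∧
    |y.1 - x.1| + y.2.1 ≤ 3 * x.2.1 / 4 ∧ y.1 ∈ coneContact F x.1 x.2.1 x.2.2 (M * c k) ∧
    |y.2.2 - x.2.2| ≤ M * c k with hQ
  have step : ∀ k (x : {x // P k x}), ∃ y : {y // P (k + 1) y}, Q k x.1 y.1 := by
    rintro k ⟨⟨b, r, σ⟩, hr, hrk, hb, hAk, hσ, hΦk⟩
    simp only at hr hrk hb hAk hσ hΦk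
    have hN : 0 < M * c k := mul_pos hM0 (hc k)
    have hr8 : r / 8 ≤ r₀ / 8 ^ (k + 1) := by
      rw [pow_succ, ← div_div]; gcongr
    have hMc : M * c k ≤ 2 * (M * c (k + 1)) := by
      have := mul_le_mul_of_nonneg_left (hhalf k) hM0.le
      linarith
    have fin : ∀ b' r' σ', 0 < r' → r' ≤ r / 8 → |b' - b| + r' ≤ 3 * r / 4 →
        b' ∈ coneContact F b r σ (M * c k) → NearlyAffine F b' r' σ' (c (k + 1)) →
        coverMass s p u b' r' ≤ (r' / 96) ^ s → |σ' - σ| ≤ M * c k → |σ'| ≤ M * c k →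
        ∃ y : {y // P (k + 1) y}, Q k (b, r, σ) y.1 := by
      intro b' r' σ' h1 h2 h3 h4 h5 h6 h7 h8
      have h9 : |b' - b₀| ≤ |b' - b| + |b - b₀| := abs_sub_le _ _ _
      exact ⟨⟨(b', r', σ'), h1, h2.trans hr8, by simp only; linarith, h5, h8.trans hMc, h6⟩,
        h2, h3, h4, h7⟩
    have hnull' := hnull b r σ (M * c k) hN.le hb
    have hZ' := (hZ (k + 1)).mono le_rfl hr8
    -- Moving the slope against its sign takes |σ| ≤ 2N to |σ'| ≤ N, and N = M c k ≤ 2 M c (k + 1)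
    -- restores the invariant.
    rcases le_total σ 0 with hs | hs
    · obtain ⟨b', r', h1, h2, h3, h4, h5, h6⟩ :=
        hAk.exists_add hF hs0 hs1 hM8 hM hr (hc k) hu hsum hΦk hZ' hnull'
      refine fin b' r' _ h1 h2 h3 h4 h5 h6 ?_ ?_
      · rw [add_sub_cancel_left, abs_of_pos hN]
      · rw [abs_of_nonpos hs] at hσ
        exact abs_le.2 ⟨by linarith, by linarith⟩
    · obtain ⟨b', r', h1, h2, h3, h4, h5, h6⟩ :=
        hAk.exists_sub hF hs0 hs1 hM8 hM hr (hc k) hu hsum hΦk hZ' hnull'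
      refine fin b' r' _ h1 h2 h3 h4 h5 h6 ?_ ?_
      · rw [sub_sub_cancel_left, abs_neg, abs_of_pos hN]
      · rw [abs_of_nonneg hs] at hσ
        exact abs_le.2 ⟨by linarith, by linarith⟩
  choose next hnext using step
  have hP0 : P 0 (b₀, r₀, 0) := by
    refine ⟨hr₀, by simp, by simp, hA, ?_, (coverMass_le_tsum hu hsum _ _).trans hΦ⟩
    have := mul_pos hM0 (hc 0)
    simp only [abs_zero]
    linarith
  set seq : (k : ℕ) → {x // P k x} := fun k => Nat.rec ⟨_, hP0⟩ (fun k x => next k x) k with hseq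
  have hQs : ∀ k, Q k (seq k).1 (seq (k + 1)).1 := fun k => hnext k (seq k)
  set b : ℕ → ℝ := fun k => (seq k).1.1 with hb
  set r : ℕ → ℝ := fun k => (seq k).1.2.1 with hr
  set σ : ℕ → ℝ := fun k => (seq k).1.2.2 with hσ
  have hrpos : ∀ k, 0 < r k := fun k => (seq k).2.1
  have hrle : ∀ k, r k ≤ r₀ / 8 ^ k := fun k => (seq k).2.2.1
  have hr0 : Tendsto r atTop (𝓝 0) := by
    have ht : Tendsto (fun k : ℕ => r₀ * (1 / 8 : ℝ) ^ k) atTop (𝓝 (r₀ * 0)) :=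
      (tendsto_pow_atTop_nhds_zero_of_lt_one (by norm_num) (by norm_num)).const_mul r₀
    rw [mul_zero] at ht
    refine squeeze_zero (fun k => (hrpos k).le) (fun k => ?_) ht
    rw [one_div, inv_pow, ← div_eq_mul_inv]
    exact hrle k
  have hsub : ∀ k, |b (k + 1) - b k| + r (k + 1) ≤ 3 * r k / 4 := fun k => (hQs k).2.1
  have hnest : Antitone fun k => closedBall (b k) (r k) := antitone_nat_of_succ_le fun k =>
    closedBall_subset_closedBall' (by
      have := hsub k
      have := hrpos k
      rw [Real.dist_eq]
      linarith)
  obtain ⟨t, ht⟩ := IsCompact.nonempty_iInter_of_sequence_nonempty_isCompact_isClosed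
    (fun k => closedBall (b k) (r k)) (fun k => hnest (Nat.le_succ k))
    (fun k => nonempty_closedBall.2 (hrpos k).le) (isCompact_closedBall _ _)
    (fun k => isClosed_closedBall)
  have htk : ∀ k, |t - b k| ≤ r k := fun k => by
    have := mem_iInter.1 ht k
    rwa [mem_closedBall, Real.dist_eq] at this
  refine ⟨t, htk 0, fun i => ?_, fun k => r k / 4, fun k => by have := hrpos k; positivity, ?_,
    fun k a ha1 ha2 => ?_⟩
  -- A covering interval containing t would meet every interval of the construction, so uᵢ ≤ r k /
  -- 96 for all k, which is impossible as r k → 0.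
  · by_contra! hi
    obtain ⟨k, hk⟩ := (hr0.eventually_lt_const (hu i)).exists
    have h1 : |p i - b k| ≤ |p i - t| + |t - b k| := abs_sub_le _ _ _
    have h2 := htk k
    have h3 := le_of_coverMass_le hs0 hu hsum (by have := hrpos k; positivity)
      (seq k).2.2.2.2.2.2 (i := i) (by change |p i - b k| ≤ r k + u i; linarith)
    have h4 : (seq k).1.2.1 = r k := rfl
    have h5 := hrpos k
    rw [h4] at h3
    linarith
  · simpa using hr0.div_const 4
  · have hcc : c (k + 1) ≤ M * c k := by
      have := hanti (Nat.le_succ k)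
      have := hc k
      simp only [Nat.succ_eq_add_one] at *
      nlinarith
    have h1 := NearlyAffine.increment_le (C := c (k + 1)) hcc (hQs k).2.2.2 (hQs k).2.2.1
      (seq (k + 1)).2.2.2.2.1 (htk (k + 1)) (hsub k) ha1 ha2
    have h2 : |σ k| ≤ 2 * (M * c k) := (seq k).2.2.2.2.2.1
    refine h1.trans ?_
    have := mul_le_mul_of_nonneg_right h2 (abs_nonneg a)
    change F t + (|σ k| + 13 * (M * c k)) * |a| ≤ _
    linarith

/-- A set containing almost every contact point and every point where the increments of `F` are
controlled has dimension at least one. -/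
theorem one_le_dimH_of_localMax {E : Set ℝ} {F : ℝ → ℝ} (hF : Continuous F) {b₀ r₀ C₀ : ℝ}
    (hr₀ : 0 < r₀) (hC₀ : 0 < C₀) (hmax : ∀ a, |a| ≤ r₀ → F (b₀ + a) ≤ F b₀)
    (hZ : LowerZygmund F C₀ r₀)
    (hcontact : ∀ b r σ N, 0 ≤ N → |b - b₀| + r ≤ r₀ → volume (coneContact F b r σ N \ E) = 0)
    (hlim : ∀ t A, |t - b₀| ≤ r₀ → (∀ᶠ a in 𝓝 0, F (t + a) ≤ F t + A * |a|) →
      ((∀ ε > 0, ∃ δ > 0, LowerZygmund F ε δ) →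
        ∀ ε > 0, ∀ᶠ a in 𝓝 0, F (t + a) ≤ F t + ε * |a|) → t ∈ E) :
    1 ≤ dimH E := by
  by_contra! hE
  have hvE : volume E = 0 := by
    rw [← hausdorffMeasure_real]
    have := hausdorffMeasure_of_dimH_lt (d := 1) (by simpa using hE)
    simpa using this
  obtain ⟨s, hs0, hs1, hcov⟩ := exists_cover_of_dimH_lt_one hE
  obtain ⟨p, u, hu, hsum, hΦ, hpu⟩ := hcov ((r₀ / 96) ^ s) (by positivity)
  obtain ⟨c, hc0, hc, hanti, hhalf, hZc, hct⟩ := exists_zygmund_constants hC₀ hr₀ hZ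
  obtain ⟨M, hM, hM8⟩ := (((tendsto_rpow_atTop (by linarith : 0 < 1 - s)).eventually_ge_atTop
    640).and (eventually_ge_atTop 8)).exists
  obtain ⟨t, htb, htu, ρ, hρ, hρ0, hinc⟩ := exists_controlled_point_notMem_cover hF hs0 hs1 hM8 hM
    hr₀ hc hanti hhalf hZc
    (NearlyAffine.of_upper (by rwa [hc0]) (by simpa using hmax))
    (fun b r σ N hN hb => measure_mono_null (fun x hx => by
      by_cases h : x ∈ E
      · exact Or.inl h
      · exact Or.inr ⟨hx, h⟩) (measure_union_null hvE (hcontact b r σ N hN hb))) hu hsum hΦ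
  obtain ⟨i, hi⟩ := hpu t (hlim t (15 * M * c 0) htb
    (eventually_le_of_scales hρ hρ0 (k₀ := 0) fun k _ a h1 h2 => (hinc k a h1 h2).trans (by
      gcongr; exact hanti (Nat.zero_le k))) fun hsmall ε hε => by
    have h1 := (hct hsmall).const_mul (15 * M)
    rw [mul_zero] at h1
    obtain ⟨k₀, hk₀⟩ := eventually_atTop.1 (h1.eventually_le_const hε)
    exact eventually_le_of_scales hρ hρ0 (k₀ := k₀) fun k hk a h2 h3 =>
      (hinc k a h2 h3).trans (by gcongr; exact hk₀ k hk))
  exact (htu i).not_ge hi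

/-- Almost every contact point is a point where the supremal convolution is differentiable. -/
theorem volume_coneContact_sdiff_eq_zero {F : ℝ → ℝ} (hF : Continuous F) (b r σ N : ℝ)
    (hN : 0 ≤ N) : volume (coneContact F b r σ N \
      {t | ∃ q : ℝ, ∀ ε > 0, ∀ᶠ a in 𝓝 0, F (t + a) ≤ F t + q * a + ε * |a|}) = 0 := by
  rcases lt_or_ge r 0 with hr | hr
  · refine measure_mono_null (fun x hx => ?_) (measure_empty (μ := volume))
    exact absurd ((abs_nonneg _).trans hx.1.1) (not_le.2 hr)
  lift N to NNReal using hN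
  obtain ⟨h, hlip, hatt, hmax⟩ := exists_supConvolution
    (g := fun x => F (b + x) - σ * x) (by fun_prop) hr N
  have hae : volume {x | ¬ DifferentiableAt ℝ h x} = 0 := hlip.ae_differentiableAt_real
  have hae' : volume ((fun x => -b + x) ⁻¹' {x | ¬ DifferentiableAt ℝ h x}) = 0 := by
    rwa [measure_preimage_add]
  have hends : volume ({b - r, b + r} : Set ℝ) = 0 := (Set.toFinite _).measure_zero _
  refine measure_mono_null (fun x hx => ?_) (measure_union_null hae' hends)
  by_contra hnot
  rw [mem_union, not_or] at hnot
  obtain ⟨hd, hne⟩ := hnot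
  simp only [mem_preimage, mem_ofPred_eq, not_not] at hd
  simp only [mem_insert_iff, mem_singleton_iff, not_or] at hne
  obtain ⟨⟨hxb, hxc⟩, hxE⟩ := hx
  -- The convolution h dominates F minus its linear part and agrees with it at a contact point, so
  -- its derivative there bounds the increments of F from above.
  refine hxE ⟨deriv h (-b + x) + σ, fun ε hε => ?_⟩
  have hlt : |x - b| < r := by
    refine lt_of_le_of_ne hxb fun heq => ?_
    rcases abs_cases (x - b) with ⟨e, _⟩ | ⟨e, _⟩
    · exact hne.2 (by linarith)
    · exact hne.1 (by linarith)
  have hhx : h (-b + x) ≤ F x - σ * (-b + x) := by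
    obtain ⟨w, hw, hwe⟩ := hatt (-b + x)
    have h1 := hxc (b + w) (by simpa [abs_le] using hw)
    rw [show b + w - x = w - (-b + x) by ring] at h1
    rw [hwe]
    linarith
  have hder := (hasDerivAt_iff_isLittleO_nhds_zero.1 hd.hasDerivAt).def hε
  filter_upwards [hder, Metric.ball_mem_nhds 0 (sub_pos.2 hlt)] with a ha1 ha2
  rw [mem_ball, Real.dist_eq, sub_zero] at ha2
  have h2 : |-b + x + a| ≤ r := by
    have := abs_add_le (x - b) a
    rw [show x - b + a = -b + x + a by ring] at this
    linarith
  have h3 := hmax (-b + x + a) (-b + x + a) (abs_le.1 h2)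
  simp only [sub_self, abs_zero, mul_zero, sub_zero] at h3
  rw [show b + (-b + x + a) = x + a by ring] at h3
  rw [Real.norm_eq_abs, Real.norm_eq_abs, smul_eq_mul] at ha1
  have h4 := (abs_le.1 ha1).2
  linarith

end OneDimensional

/-! ### Reduction to one variable by maximising over slices -/

section SliceSupremum

open MeasureTheory Set Metric

variable {V : Type*} [NormedAddCommGroup V] [InnerProductSpace ℝ V]

theorem norm_add_smul_sq_of_inner_eq_zero {e y : V} (he : ‖e‖ = 1) (hy : inner ℝ e y = 0) (t : ℝ) :
    ‖t • e + y‖ ^ 2 = t ^ 2 + ‖y‖ ^ 2 := by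
  rw [norm_add_sq_real, inner_smul_left, hy, norm_smul, he]
  simp

/-- By the parallelogram law, the second difference of K‖· - c‖² is exactly 2K‖k‖². -/
theorem le_add_sub_norm_sq {f : V → ℝ} {x k : V} {C : ℝ} (K : ℝ) (c : V)
    (h : 2 * f x - C * ‖k‖ ≤ f (x + k) + f (x - k)) :
    2 * (f x - K * ‖x - c‖ ^ 2) - C * ‖k‖ - 2 * K * ‖k‖ ^ 2 ≤
      (f (x + k) - K * ‖x + k - c‖ ^ 2) + (f (x - k) - K * ‖x - k - c‖ ^ 2) := by
  have h1 := parallelogram_law_with_norm ℝ (x - c) k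
  rw [show x - c + k = x + k - c by abel, show x - c - k = x - k - c by abel] at h1
  have h2 : K * (‖x + k - c‖ ^ 2 + ‖x - k - c‖ ^ 2) = K * (2 * (‖x - c‖ ^ 2 + ‖k‖ ^ 2)) := by
    rw [pow_two, pow_two, pow_two, pow_two]
    exact congrArg (K * ·) (by linarith)
  linarith

/-- For functions satisfying a one-sided Zygmund condition, upper bounds for the increments at a
point are two-sided bounds. -/
theorem eventually_abs_increment_le {f : V → ℝ} {x c e : V} {K P A C δ : ℝ} (hK : 0 < K)
    (hδ : 0 < δ) (hA : 0 < A) (hZ : ∀ k, ‖k‖ ≤ δ → 2 * f x - C * ‖k‖ ≤ f (x + k) + f (x - k))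
    (h : ∀ᶠ k in 𝓝 0, f (x + k) - K * ‖x + k - c‖ ^ 2 ≤
      f x - K * ‖x - c‖ ^ 2 + P * inner ℝ e k + A * ‖k‖) (hC : 0 ≤ C) :
    ∀ᶠ k in 𝓝 0, |(f (x + k) - K * ‖x + k - c‖ ^ 2) - (f x - K * ‖x - c‖ ^ 2) - P * inner ℝ e k| ≤
      (2 * A + C) * ‖k‖ := by
  have hneg : Tendsto (fun k : V => -k) (𝓝 0) (𝓝 0) := by
    simpa using (continuous_neg (G := V)).tendsto 0
  filter_upwards [h, hneg.eventually h, Metric.ball_mem_nhds (0 : V) hδ,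
    Metric.ball_mem_nhds (0 : V) (by positivity : 0 < A / (2 * K))] with k h1 h2 h3 h4
  rw [mem_ball_zero_iff] at h3 h4
  have h5 := le_add_sub_norm_sq K c (hZ k h3.le)
  rw [← sub_eq_add_neg, norm_neg, inner_neg_right] at h2
  have h6 : 2 * K * ‖k‖ ^ 2 ≤ A * ‖k‖ := by
    rw [lt_div_iff₀ (by positivity)] at h4
    nlinarith [norm_nonneg k]
  have h7 : 0 ≤ A * ‖k‖ := by positivity
  have h8 : 0 ≤ C * ‖k‖ := by positivity
  rw [abs_le]
  constructor <;> linarith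

/-- The supremum of `f - K ‖· - c‖ ^ 2` over small slices orthogonal to `e`, as a function of the
position of the slice: it is a one-sided Zygmund function with a local maximum, and its upper
increments control those of `f - K ‖· - c‖ ^ 2` at a point of the slice. -/
theorem exists_sliceSup [FiniteDimensional ℝ V] {f : V → ℝ} (hf : Continuous f) {M K ρ : ℝ} (hM : ∀ x, |f x| ≤ M)
    (hK : 0 < K) (hρ : 0 < ρ) (hKρ : 2 * M < K * ρ ^ 2) {e : V} (he : ‖e‖ = 1) (c : V) :
    ∃ F : ℝ → ℝ, Continuous F ∧
      (∀ C δ, (∀ x h, ‖h‖ ≤ δ → 2 * f x - C * ‖h‖ ≤ f (x + h) + f (x - h)) →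
        LowerZygmund F (C + 2 * K * δ) δ) ∧
      (∃ b₀, |b₀| < ρ ∧ ∀ t, |t| ≤ ρ → F t ≤ F b₀) ∧
      ∀ t, ∃ x, inner ℝ e (x - c) = t ∧ ‖x - c‖ ≤ |t| + ρ ∧ ∀ P A, 0 ≤ A →
        (∀ᶠ a in 𝓝 0, F (t + a) ≤ F t + P * a + A * |a|) →
        ∀ᶠ k in 𝓝 0, f (x + k) - K * ‖x + k - c‖ ^ 2 ≤
          f x - K * ‖x - c‖ ^ 2 + P * inner ℝ e k + A * ‖k‖ := by
  set q : V → ℝ := fun x => f x - K * ‖x - c‖ ^ 2 with hq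
  have hqc : Continuous q := by fun_prop
  set B : Set V := {y | inner ℝ e y = 0} ∩ closedBall 0 ρ with hB
  have hBc : IsCompact B := (isCompact_closedBall (0 : V) ρ).inter_left
    (isClosed_eq (by fun_prop) continuous_const)
  have h0B : (0 : V) ∈ B := ⟨inner_zero_right e, by simp [hρ.le]⟩
  set F : ℝ → ℝ := fun t => sSup ((fun y => q (c + t • e + y)) '' B) with hF
  have hFc : Continuous F := hBc.continuous_sSup (f := fun t y => q (c + t • e + y)) (by fun_prop)
  have hle : ∀ t, ∀ y ∈ B, q (c + t • e + y) ≤ F t := fun t y hy =>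
    le_csSup (hBc.image (by fun_prop)).bddAbove (mem_image_of_mem _ hy)
  have hatt : ∀ t, ∃ y ∈ B, F t = q (c + t • e + y) := fun t => by
    obtain ⟨y, hy, h, -⟩ := hBc.exists_sSup_image_eq_and_ge (f := fun y => q (c + t • e + y))
      ⟨0, h0B⟩ (by fun_prop)
    exact ⟨y, hy, h⟩
  have hqB : ∀ t, ∀ y ∈ B, q (c + t • e + y) = f (c + t • e + y) - K * (t ^ 2 + ‖y‖ ^ 2) := by
    intro t y hy
    simp only [hq]
    rw [← norm_add_smul_sq_of_inner_eq_zero he hy.1, add_assoc, add_sub_cancel_left]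
  have hlow : ∀ t, -M - K * t ^ 2 ≤ F t := fun t => by
    have h1 := hle t 0 h0B
    rw [hqB t 0 h0B, norm_zero] at h1
    have h2 := (abs_le.1 (hM (c + t • e + 0))).1
    linarith
  refine ⟨F, hFc, fun C δ hZ t s hs hsδ => ?_, ?_, fun t => ?_⟩
  · obtain ⟨y, hy, hty⟩ := hatt t
    have h1 := hle (t + s) y hy
    have h2 := hle (t - s) y hy
    have hn : ‖s • e‖ = s := by rw [norm_smul, he, mul_one, Real.norm_of_nonneg hs]
    have h3 := hZ (c + t • e + y) (s • e) (by rw [hn]; exact hsδ)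
    rw [hn] at h3
    rw [hqB _ y hy] at h1 h2 hty
    rw [show c + (t + s) • e + y = c + t • e + y + s • e by module] at h1
    rw [show c + (t - s) • e + y = c + t • e + y - s • e by module] at h2
    have h4 : K * (s * s) ≤ K * (δ * s) := by gcongr
    rw [hty]
    linarith
  · obtain ⟨b₀, hb, hmax⟩ := (isCompact_Icc (a := -ρ) (b := ρ)).exists_isMaxOn
      ⟨0, by constructor <;> linarith⟩ hFc.continuousOn
    have hmax' := isMaxOn_iff.1 hmax
    refine ⟨b₀, lt_of_le_of_ne (abs_le.2 hb) fun heq => ?_, fun t ht => hmax' t (abs_le.1 ht)⟩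
    -- At |b₀| = ρ the penalty would give F b₀ ≤ M - Kρ² < -M ≤ F 0.
    have h1 := hmax' 0 ⟨by linarith, by linarith⟩
    have h2 := hlow 0
    obtain ⟨y, hy, hby⟩ := hatt b₀
    rw [hqB b₀ y hy] at hby
    have h3 := (abs_le.1 (hM (c + b₀ • e + y))).2
    rw [← sq_abs b₀, heq] at hby
    have h4 : 0 ≤ K * ‖y‖ ^ 2 := by positivity
    linarith
  · obtain ⟨y, hy, hty⟩ := hatt t
    have hyρ : ‖y‖ < ρ := by
      refine lt_of_le_of_ne (by simpa using hy.2) fun heq => ?_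
      have h1 := hlow t
      rw [hty, hqB t y hy, heq] at h1
      have h3 := (abs_le.1 (hM (c + t • e + y))).2
      linarith
    have hee : inner ℝ e e = (1 : ℝ) := by rw [real_inner_self_eq_norm_sq, he, one_pow]
    refine ⟨c + t • e + y, ?_, ?_, fun P A hA h => ?_⟩
    · rw [add_assoc, add_sub_cancel_left, inner_add_right, inner_smul_right, hy.1, hee]
      simp
    · rw [add_assoc, add_sub_cancel_left]
      refine (norm_add_le _ _).trans ?_
      rw [norm_smul, he, mul_one, Real.norm_eq_abs]
      linarith
    · have hcont : Tendsto (fun k : V => (inner ℝ e k : ℝ)) (𝓝 0) (𝓝 0) := by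
        have : Continuous fun k : V => (inner ℝ e k : ℝ) := by fun_prop
        simpa using this.tendsto 0
      filter_upwards [hcont.eventually h,
        Metric.ball_mem_nhds (0 : V) (half_pos (sub_pos.2 hyρ))] with k hk1 hk2
      rw [mem_ball_zero_iff] at hk2
      have hin : |(inner ℝ e k : ℝ)| ≤ ‖k‖ := by
        simpa [he] using abs_real_inner_le_norm e k
      -- The component of k along e is absorbed by the height. The rest moves y by at most 2‖k‖,
      -- less than its distance ρ - ‖y‖ to the rim of the disc.
      have hyk : y + k - (inner ℝ e k : ℝ) • e ∈ B := by
        constructor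
        · change inner ℝ e (y + k - (inner ℝ e k : ℝ) • e) = 0
          have := hy.1
          change inner ℝ e y = (0 : ℝ) at this
          rw [inner_sub_right, inner_add_right, inner_smul_right, this, hee]
          ring
        · rw [mem_closedBall_zero_iff]
          have h1 := norm_sub_le (y + k) ((inner ℝ e k : ℝ) • e)
          have h2 := norm_add_le y k
          rw [norm_smul, he, mul_one, Real.norm_eq_abs] at h1
          linarith
      have h3 := hle (t + inner ℝ e k) _ hyk
      rw [show c + (t + inner ℝ e k) • e + (y + k - (inner ℝ e k : ℝ) • e) =
        c + t • e + y + k by module] at h3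
      have h4 := mul_le_mul_of_nonneg_left hin hA
      change q (c + t • e + y + k) ≤ q (c + t • e + y) + P * inner ℝ e k + A * ‖k‖
      linarith

/-- Dimension bound for sets containing the points where `f - K ‖· - c‖ ^ 2` has upper increments
controlled by a linear function. -/
theorem one_le_dimH_of_upper_increments [FiniteDimensional ℝ V] {f : V → ℝ} (hf : Continuous f) {M C K ρ : ℝ}
    (hM : ∀ x, |f x| ≤ M) (hC : 0 ≤ C)
    (hZ : ∀ x h, 2 * f x - C * ‖h‖ ≤ f (x + h) + f (x - h)) (hK : 0 < K) (hρ : 0 < ρ)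
    (hKρ : 2 * M < K * ρ ^ 2) {e : V} (he : ‖e‖ = 1) (c : V) {G : Set V}
    (hG : ∀ x, ‖x - c‖ < 2 * ρ →
      (∃ A, ∀ᶠ k in 𝓝 0,
        f (x + k) - K * ‖x + k - c‖ ^ 2 ≤ f x - K * ‖x - c‖ ^ 2 + A * ‖k‖) →
      ((∀ ε > 0, ∃ δ > 0, ∀ x h, ‖h‖ ≤ δ → 2 * f x - ε * ‖h‖ ≤ f (x + h) + f (x - h)) →
        ∃ P : ℝ, ∀ ε > 0, ∀ᶠ k in 𝓝 0, f (x + k) - K * ‖x + k - c‖ ^ 2 ≤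
          f x - K * ‖x - c‖ ^ 2 + P * inner ℝ e k + ε * ‖k‖) → x ∈ G) :
    1 ≤ dimH G := by
  obtain ⟨F, hF, hFZ, ⟨b₀, hb₀, hmax⟩, hpt⟩ := exists_sliceSup hf hM hK hρ hKρ he c
  have hlip : LipschitzWith 1 fun x : V => (inner ℝ e (x - c) : ℝ) :=
    LipschitzWith.of_dist_le_mul fun x y => by
      rw [Real.dist_eq, ← inner_sub_right, sub_sub_sub_cancel_right, dist_eq_norm]
      simpa [he] using abs_real_inner_le_norm e (x - y)
  refine le_trans ?_ (hlip.dimH_image_le G)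
  -- Half the gap keeps all heights within r₀ of b₀ below ρ in modulus, so that the maximisers
  -- satisfy ‖x - c‖ < 2ρ.
  set r₀ := (ρ - |b₀|) / 2 with hr₀
  have hr₀pos : 0 < r₀ := half_pos (sub_pos.2 hb₀)
  have htρ : ∀ t, |t - b₀| ≤ r₀ → |t| < ρ := fun t ht => by
    have := abs_sub_abs_le_abs_sub t b₀
    linarith
  have hsmall : (∀ ε > 0, ∃ δ > 0, ∀ x h, ‖h‖ ≤ δ →
      2 * f x - ε * ‖h‖ ≤ f (x + h) + f (x - h)) → ∀ ε > 0, ∃ δ > 0, LowerZygmund F ε δ := by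
    intro h ε hε
    obtain ⟨δ, hδ, hδZ⟩ := h (ε / 2) (by positivity)
    have hm : 0 < min δ (ε / (4 * K)) := by positivity
    refine ⟨min δ (ε / (4 * K)), hm, (hFZ (ε / 2) _ fun x h hh =>
      hδZ x h (hh.trans (min_le_left _ _))).mono ?_ le_rfl⟩
    have h1 : 2 * K * min δ (ε / (4 * K)) ≤ 2 * K * (ε / (4 * K)) := by
      gcongr
      exact min_le_right _ _
    have h2 : 2 * K * (ε / (4 * K)) = ε / 2 := by field_simp; norm_num
    linarith
  refine one_le_dimH_of_localMax hF hr₀pos (C₀ := C + 2 * K * r₀) (by positivity)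
    (b₀ := b₀) (fun a ha => hmax _ ?_) (hFZ C r₀ fun x h _ => hZ x h) ?_ ?_
  · exact (htρ _ (by simpa using ha)).le
  · intro b r σ N hN hb
    refine measure_mono_null ?_ (volume_coneContact_sdiff_eq_zero hF b r σ N hN)
    rintro t ⟨ht, htG⟩
    refine ⟨ht, fun ⟨P, hP⟩ => htG ?_⟩
    have htb : |t - b₀| ≤ r₀ := (abs_sub_le t b b₀).trans (by linarith [ht.1])
    obtain ⟨x, hxt, hxn, hx⟩ := hpt t
    refine ⟨x, hG x (by linarith [htρ t htb]) ⟨|P| + 1, ?_⟩ fun _ => ⟨P, fun ε hε =>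
      hx P ε hε.le (hP ε hε)⟩, hxt⟩
    have := hx 0 (|P| + 1) (by positivity) (by
      filter_upwards [hP 1 one_pos] with a ha
      have h1 : P * a ≤ |P| * |a| := by rw [← abs_mul]; exact le_abs_self _
      linarith)
    simpa using this
  · intro t A htb hA hs
    obtain ⟨x, hxt, hxn, hx⟩ := hpt t
    refine ⟨x, hG x (by linarith [htρ t htb]) ⟨|A|, ?_⟩ fun h => ⟨0, fun ε hε => ?_⟩, hxt⟩
    · have := hx 0 |A| (abs_nonneg A) (by
        filter_upwards [hA] with a ha
        have := mul_le_mul_of_nonneg_right (le_abs_self A) (abs_nonneg a)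
        linarith)
      simpa using this
    · exact hx 0 ε hε.le (by
        filter_upwards [hs (hsmall h) ε hε] with a ha
        linarith)

end SliceSupremum

/-! ### Bounded divided differences and differentiability in cubes -/

section Zygmund

open MeasureTheory Set Metric

theorem one_le_dimH_inter_openCube {d : ℕ} (hd : 1 ≤ d) {f : EuclideanSpace ℝ (Fin d) → ℝ}
    (hf : f ∈ zygmundClass d) (a : EuclideanSpace ℝ (Fin d)) {r : ℝ} (hr : 0 < r)
    {S : Set (EuclideanSpace ℝ (Fin d))}
    (hS : ∀ x c e K, 0 < K →
      (∃ A, ∀ᶠ k in 𝓝 0,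
        f (x + k) - K * ‖x + k - c‖ ^ 2 ≤ f x - K * ‖x - c‖ ^ 2 + A * ‖k‖) →
      ((∀ ε > 0, ∃ δ > 0, ∀ x h, ‖h‖ ≤ δ → 2 * f x - ε * ‖h‖ ≤ f (x + h) + f (x - h)) →
        ∃ P : ℝ, ∀ ε > 0, ∀ᶠ k in 𝓝 0, f (x + k) - K * ‖x + k - c‖ ^ 2 ≤
          f x - K * ‖x - c‖ ^ 2 + P * inner ℝ e k + ε * ‖k‖) → x ∈ S) :
    1 ≤ dimH (S ∩ openCube a r) := by
  obtain ⟨⟨M, hM⟩, hfc, C, hC⟩ := hf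
  have hM0 : 0 ≤ M := (abs_nonneg _).trans (hM 0)
  have hK : 0 < (2 * M + 1) / (r / 4) ^ 2 := by positivity
  have he : ‖(EuclideanSpace.single ⟨0, hd⟩ 1 : EuclideanSpace ℝ (Fin d))‖ = 1 := by simp
  -- With ρ = r/4 and c the centre of the cube, the ball of radius 2ρ = r/2 about c lies in the
  -- cube; K is chosen so that Kρ² = 2M + 1.
  refine one_le_dimH_of_upper_increments hfc hM (abs_nonneg C) (fun x h => ?_) hK
    (by positivity : 0 < r / 4) (by rw [div_mul_cancel₀ _ (by positivity)]; linarith) he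
    (a + WithLp.toLp 2 fun _ => r / 2) fun x hx h1 h2 => ⟨hS x _ _ _ hK h1 h2, fun i => ?_⟩
  · have h1 := (abs_le.1 (hC x h)).1
    have h2 := mul_le_mul_of_nonneg_right (le_abs_self C) (norm_nonneg h)
    linarith
  · have h3 := (PiLp.norm_apply_le (x - (a + WithLp.toLp 2 fun _ => r / 2)) i).trans_lt hx
    rw [Real.norm_eq_abs, abs_lt] at h3
    simp only [PiLp.sub_apply, PiLp.add_apply] at h3
    constructor <;> linarith

theorem mem_boundedDivDiffSet_of_eventually {d : ℕ} {f : EuclideanSpace ℝ (Fin d) → ℝ}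
    {x : EuclideanSpace ℝ (Fin d)} {A : ℝ} (h : ∀ᶠ k in 𝓝 0, |f (x + k) - f x| ≤ A * ‖k‖) :
    x ∈ boundedDivDiffSet f := by
  change limsup (fun h => ENNReal.ofReal (|f (x + h) - f x| / ‖h‖)) (𝓝[≠] 0) < ⊤
  refine (limsup_le_of_le (h := ?_)).trans_lt (ENNReal.ofReal_lt_top (r := A))
  filter_upwards [h.filter_mono nhdsWithin_le_nhds, self_mem_nhdsWithin] with k hk hk0
  exact ENNReal.ofReal_le_ofReal ((div_le_iff₀ (norm_pos_iff.2 hk0)).2 hk)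

theorem one_le_dimH_boundedDivDiffSet_inter_openCube {d : ℕ} (hd : 1 ≤ d)
    {f : EuclideanSpace ℝ (Fin d) → ℝ} (hf : f ∈ zygmundClass d) (a : EuclideanSpace ℝ (Fin d))
    {r : ℝ} (hr : 0 < r) : 1 ≤ dimH (boundedDivDiffSet f ∩ openCube a r) := by
  refine one_le_dimH_inter_openCube hd hf a hr fun x c e K hK ⟨A, hA⟩ _ => ?_
  obtain ⟨-, -, C, hC⟩ := hf
  have h1 := eventually_abs_increment_le (P := 0) (e := 0) (A := |A| + 1) (C := |C|) hK one_pos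
    (by positivity) (fun k _ => by
      have h1 := (abs_le.1 (hC x k)).1
      have h2 := mul_le_mul_of_nonneg_right (le_abs_self C) (norm_nonneg k)
      linarith) (hA.mono fun k hk => by
      have h2 := mul_le_mul_of_nonneg_right (le_abs_self A) (norm_nonneg k)
      have h3 := norm_nonneg k
      rw [zero_mul]
      linarith) (abs_nonneg C)
  refine mem_boundedDivDiffSet_of_eventually
    (A := 2 * (|A| + 1) + |C| + K * (2 * ‖x - c‖ + 1)) ?_
  filter_upwards [h1, Metric.ball_mem_nhds 0 one_pos] with k hk hk1
  rw [mem_ball_zero_iff] at hk1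
  rw [zero_mul, sub_zero, abs_le] at hk
  have h2 : ‖x + k - c‖ ^ 2 = ‖x - c‖ ^ 2 + 2 * inner ℝ (x - c) k + ‖k‖ ^ 2 := by
    rw [← norm_add_sq_real]; congr 2; abel
  have h3 := abs_le.1 (abs_real_inner_le_norm (x - c) k)
  rw [h2] at hk
  have h4 : ‖k‖ ^ 2 ≤ ‖k‖ := by nlinarith [norm_nonneg k]
  have h5 : |K * (2 * inner ℝ (x - c) k + ‖k‖ ^ 2)| ≤ K * ((2 * ‖x - c‖ + 1) * ‖k‖) := by
    rw [abs_mul, abs_of_pos hK]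
    refine mul_le_mul_of_nonneg_left (abs_le.2 ⟨?_, ?_⟩) hK.le
    · nlinarith [norm_nonneg k]
    · nlinarith [norm_nonneg k]
  rw [abs_le] at h5 ⊢
  constructor <;> linarith

theorem one_le_dimH_differentiabilitySet_inter_openCube {d : ℕ} (hd : 1 ≤ d)
    {f : EuclideanSpace ℝ (Fin d) → ℝ} (hf : f ∈ smallZygmundClass d)
    (a : EuclideanSpace ℝ (Fin d)) {r : ℝ} (hr : 0 < r) :
    1 ≤ dimH (differentiabilitySet f ∩ openCube a r) := by
  obtain ⟨hfz, hsmall⟩ := hf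
  have hsmall' : ∀ ε > 0, ∃ δ > 0, ∀ x h, ‖h‖ ≤ δ →
      2 * f x - ε * ‖h‖ ≤ f (x + h) + f (x - h) := by
    intro ε hε
    obtain ⟨δ, hδ, hZ⟩ := hsmall ε hε
    refine ⟨δ / 2, by positivity, fun x h hh => ?_⟩
    have := (abs_le.1 (hZ x h (by linarith))).1
    linarith
  refine one_le_dimH_inter_openCube hd hfz a hr fun x c e K hK _ hx => ?_
  obtain ⟨P, hP⟩ := hx hsmall'
  -- The gradient of the penalised function is P e: the maximum over the disc kills the derivative
  -- orthogonal to e. The penalty is smooth and is added back at the end.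
  have hq : HasFDerivAt (fun y => f y - K * ‖y - c‖ ^ 2) (P • innerSL ℝ e) x := by
    rw [hasFDerivAt_iff_isLittleO_nhds_zero, Asymptotics.isLittleO_iff]
    intro ε hε
    obtain ⟨δ, hδ, hZ⟩ := hsmall' (ε / 3) (by positivity)
    refine (eventually_abs_increment_le hK hδ (by positivity : 0 < ε / 3) (hZ x)
      (hP (ε / 3) (by positivity)) (by positivity)).mono fun k hk => ?_
    rw [show 2 * (ε / 3) + ε / 3 = ε by ring] at hk
    simpa using hk
  have hnorm : DifferentiableAt ℝ (fun y : EuclideanSpace ℝ (Fin d) => K * ‖y - c‖ ^ 2) x :=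
    ((differentiableAt_id.sub_const c).norm_sq ℝ).const_mul K
  have := hq.differentiableAt.add hnorm
  change DifferentiableAt ℝ f x
  refine this.congr_of_eventuallyEq (Eventually.of_forall fun y => ?_)
  simp

end Zygmund

theorem theorem1 (d : ℕ) (hd : 1 ≤ d) :
    (∀ f : EuclideanSpace ℝ (Fin d) → ℝ, f ∈ zygmundClass d →
      1 ≤ dimH (boundedDivDiffSet f) ∧
      ∀ (a : EuclideanSpace ℝ (Fin d)) (r : ℝ), 0 < r →
        1 ≤ dimH (boundedDivDiffSet f ∩ openCube a r)) ∧
    (∀ f : EuclideanSpace ℝ (Fin d) → ℝ, f ∈ smallZygmundClass d →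
      1 ≤ dimH (differentiabilitySet f) ∧
      ∀ (a : EuclideanSpace ℝ (Fin d)) (r : ℝ), 0 < r →
        1 ≤ dimH (differentiabilitySet f ∩ openCube a r)) := by
  refine ⟨fun f hf => ⟨?_, fun a r hr => ?_⟩, fun f hf => ⟨?_, fun a r hr => ?_⟩⟩
  · exact (one_le_dimH_boundedDivDiffSet_inter_openCube hd hf 0 one_pos).trans
      (dimH_mono Set.inter_subset_left)
  · exact one_le_dimH_boundedDivDiffSet_inter_openCube hd hf a hr
  · exact (one_le_dimH_differentiabilitySet_inter_openCube hd hf 0 one_pos).trans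
      (dimH_mono Set.inter_subset_left)
  · exact one_le_dimH_differentiabilitySet_inter_openCube hd hf a hr
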